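/- Let $d \ge 1$ and let $\psi \in C_0^\infty(-1,1)$ be a smooth function on $\mathbb{R}$ with compact support in $(-1,1)$. Write $\langle \xi\rangle = (1+|\xi|^2)^{1/2}$ for $\xi \in \mathbb{R}^d$. For $\kappa \in \mathbb{R}$, $\varepsilon > 0$ and $(x,t) \in \mathbb{R}^d \times \mathbb{R}$ define $$ \mathcal{K}_{\kappa,\varepsilon}(x,t) = \int_{\mathbb{R}^d} e^{i(x\cdot\xi + t\langle\xi\rangle)}\, \psi(\varepsilon|\xi|)\, (1+|\xi|^2)^{-\frac{d+2}{4}-i\kappa}\, \mathrm{d}\xi . $$ Then there exist constants $C < \infty$ and $N > 0$, depending only on $d$ and $\psi$, such that $$ |\mathcal{K}_{\kappa,\varepsilon}(x,t)| \le C\,(1+|\kappa|)^N\, |t|^{-\frac d2} $$ for all $\kappa \in \mathbb{R}$, $\varepsilon > 0$, $x \in \mathbb{R}^d$ and $t \in \mathbb{R}\setminus\{0\}$. -/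

import Mathlib

open MeasureTheory

noncomputable section

/-- The Japanese bracket `⟨ξ⟩ = (1 + |ξ|²)^{1/2}` on `ℝ^d`. -/
def japaneseBracket {d : ℕ} (ξ : EuclideanSpace ℝ (Fin d)) : ℝ :=
  Real.sqrt (1 + ‖ξ‖ ^ 2)

/-- The damped Klein–Gordon oscillatory integral
`𝒦_{κ,ε}(x,t) = ∫ e^{i(x·ξ + t⟨ξ⟩)} ψ(ε|ξ|) (1 + |ξ|²)^{-(d+2)/4 - iκ} dξ` over `ℝ^d`. The complex
power has the positive base `1 + |ξ|²`. -/
def kleinGordonIntegral {d : ℕ} (ψ : ℝ → ℂ) (κ ε : ℝ) (x : EuclideanSpace ℝ (Fin d)) (t : ℝ) : ℂ :=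
  ∫ ξ : EuclideanSpace ℝ (Fin d),
    Complex.exp (Complex.I * ((inner ℝ x ξ + t * japaneseBracket ξ : ℝ) : ℂ)) *
      ψ (ε * ‖ξ‖) *
      ((1 + ‖ξ‖ ^ 2 : ℝ) : ℂ) ^ (-((d : ℂ) + 2) / 4 - Complex.I * (κ : ℂ))

end

/-!
The cutoff and the dispersion are separated. On `[0, ∞)` write `ψ(r) = e^{-r} φ(r)` with `φ` smooth and
compactly supported, so that Fourier inversion for `φ` presents `ψ(ε|ξ|)` as a superposition of
`e^{-ε(1 - 2πib)|ξ|}` with rapidly decreasing weight in `b`. By subordination each of these functions is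
a superposition of complex Gaussians, hence a convolution operator whose `L¹` norm is polynomial in `b`
and does not see `ε`. So the cutoff may be dropped (`exists_fourierMultBound_cutoff`), provided that the
resulting integral is kept convergent by a damping factor `e^{-δ⟨ξ⟩}` and estimated uniformly in `δ`;
at the end `δ` tends to zero.

Without the cutoff, let `d = n + 1` and integrate over the `n` variables orthogonal to `x`. With
`⟨(η, ρ)⟩ = ⟨η⟩⟨y⟩` for `ρ = ⟨η⟩ y`, this inner integral is a function of `z = (δ - it)⟨η⟩` times a power
of `⟨η⟩` (`integral_kgSymbol_slice`). In the radial variable `v = ⟨y⟩ - 1` it is a Laplace transform in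
`z`, and it equals `e^{-z} z^{-n/2} b(z)` with `b` bounded and `b' = O(|z|^{-2})`, all constants being
polynomial in `κ` (`exists_transverseIntegral_symbol`). What remains is
`(δ - it)^{-n/2} ∫ e^{i(|x|η + t⟨η⟩)} ⟨η⟩^{-3/2 - 2iκ} e^{-δ⟨η⟩} b dη`, and the integral has to be
`O(|t|^{-1/2})`.

Here the exponent `3/2` is critical: in the variable `θ = ∫ ⟨η⟩^{-3/2} dη` the phase
`Xη + t⟨η⟩ - 2κ log ⟨η⟩` is uniformly convex when `X ≥ -t`, as long as `⟨η⟩ ≤ t / (16 (1 + |κ|))`, and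
for `X < -t` it is not stationary at all (`norm_integral_kgPhase_le`). Larger frequencies contribute at
most `∫_{t/(1+|κ|)}^∞ η^{-3/2} dη`, which is of the required size. The factor `e^{-δ⟨η⟩} b` has bounded
variation, uniformly in `δ`, so that it can be inserted by partial integration
(`exists_norm_integral_modelIntegrand_le`).
-/

/-! ### Van der Corput estimates with weights -/

/-- Van der Corput's second derivative test with respect to the measure `w dx`: if `φ' = g w` and
`g' ≥ lam w`, then the phase has second derivative at least `lam` in the variable `∫ w`. Instead of
splitting at the stationary point, integrate by parts against `g / (g² + lam)`; every remaining term is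
controlled by `∫ g' / (g² + lam)`, which is an arctangent. -/
theorem norm_integral_exp_mul_le_of_weighted_convex {φ g g' w : ℝ → ℝ} {lam a b : ℝ} (hab : a ≤ b)
    (hlam : 0 < lam) (hw : Continuous w) (hg' : Continuous g')
    (hφ : ∀ x, HasDerivAt φ (g x * w x) x) (hg : ∀ x, HasDerivAt g (g' x) x)
    (hw0 : ∀ x ∈ Set.Icc a b, 0 ≤ w x) (hconv : ∀ x ∈ Set.Icc a b, lam * w x ≤ g' x) :
    ‖∫ x in a..b, Complex.exp (Complex.I * φ x) * w x‖ ≤ 8 / √lam := by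
  have hφc : Continuous φ := continuous_iff_continuousAt.2 fun x => (hφ x).continuousAt
  have hgc : Continuous g := continuous_iff_continuousAt.2 fun x => (hg x).continuousAt
  have hpos : ∀ x, 0 < g x ^ 2 + lam := fun x => by positivity
  set k : ℝ → ℝ := fun x => g x / (g x ^ 2 + lam) with hk
  set k' : ℝ → ℝ := fun x => g' x * (lam - g x ^ 2) / (g x ^ 2 + lam) ^ 2 with hk'
  have hkd : ∀ x, HasDerivAt k (k' x) x := fun x => by
    have h := (hg x).div (((hg x).pow 2).add_const lam) (hpos x).ne'
    refine h.congr_deriv ?_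
    simp only [hk', Pi.pow_apply]
    congr 1
    push_cast
    ring
  have hk'c : Continuous k' := by
    simp only [hk']
    exact (hg'.mul (continuous_const.sub (hgc.pow 2))).div (((hgc.pow 2).add continuous_const).pow 2)
      (fun x => pow_ne_zero 2 (hpos x).ne')
  have hed : ∀ x, HasDerivAt (fun x : ℝ => Complex.exp (Complex.I * φ x))
      (Complex.exp (Complex.I * φ x) * (Complex.I * ((g x * w x : ℝ) : ℂ))) x := fun x =>
    (((hφ x).ofReal_comp).const_mul Complex.I).cexp
  have hec : Continuous (fun x : ℝ => Complex.exp (Complex.I * φ x)) := by fun_prop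
  have hG : ∀ x, HasDerivAt (fun x : ℝ => -Complex.I * (Complex.exp (Complex.I * φ x) * (k x : ℂ)))
      (Complex.exp (Complex.I * φ x) * w x -
        Complex.exp (Complex.I * φ x) * ((lam * w x / (g x ^ 2 + lam) : ℝ) : ℂ) -
        Complex.I * (Complex.exp (Complex.I * φ x) * (k' x : ℂ))) x := fun x => by
    refine (((hed x).mul (hkd x).ofReal_comp).const_mul (-Complex.I)).congr_deriv ?_
    have h1 : (w x : ℂ) - ((lam * w x / (g x ^ 2 + lam) : ℝ) : ℂ) = ((g x * w x : ℝ) : ℂ) * (k x : ℂ) := by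
      rw [← Complex.ofReal_sub, ← Complex.ofReal_mul]
      congr 1
      simp only [hk]
      field_simp [(hpos x).ne']
      ring
    have h2 : Complex.exp (Complex.I * φ x) * w x -
        Complex.exp (Complex.I * φ x) * ((lam * w x / (g x ^ 2 + lam) : ℝ) : ℂ) =
        Complex.exp (Complex.I * φ x) * (((g x * w x : ℝ) : ℂ) * (k x : ℂ)) := by
      rw [← h1]; ring
    rw [h2]
    linear_combination (-Complex.exp (Complex.I * φ x) * (((g x * w x : ℝ) : ℂ) * (k x : ℂ))) * Complex.I_sq
  have hwc : Continuous (fun x => lam * w x / (g x ^ 2 + lam)) :=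
    (continuous_const.mul hw).div ((hgc.pow 2).add continuous_const) (fun x => (hpos x).ne')
  have i1 : IntervalIntegrable (fun x : ℝ => Complex.exp (Complex.I * φ x) * w x) volume a b :=
    (hec.mul (Complex.continuous_ofReal.comp hw)).intervalIntegrable _ _
  have i2 : IntervalIntegrable (fun x : ℝ => Complex.exp (Complex.I * φ x) *
      ((lam * w x / (g x ^ 2 + lam) : ℝ) : ℂ)) volume a b :=
    (hec.mul (Complex.continuous_ofReal.comp hwc)).intervalIntegrable _ _
  have i3 : IntervalIntegrable (fun x : ℝ => Complex.I * (Complex.exp (Complex.I * φ x) * (k' x : ℂ)))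
      volume a b :=
    (continuous_const.mul (hec.mul (Complex.continuous_ofReal.comp hk'c))).intervalIntegrable _ _
  have key := intervalIntegral.integral_eq_sub_of_hasDerivAt (fun x _ => hG x) ((i1.sub i2).sub i3)
  rw [intervalIntegral.integral_sub (i1.sub i2) i3, intervalIntegral.integral_sub i1 i2] at key
  have hs : 0 < √lam := Real.sqrt_pos.2 hlam
  have hss : √lam ^ 2 = lam := Real.sq_sqrt hlam.le
  have hne : ∀ x, ‖Complex.exp (Complex.I * φ x)‖ = 1 := fun x => by
    rw [mul_comm]; exact Complex.norm_exp_ofReal_mul_I _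
  -- the arctangent primitive dominating both error terms
  have hatan : ∀ x, HasDerivAt (fun x => Real.arctan (g x / √lam) / √lam) (g' x / (g x ^ 2 + lam)) x := fun x => by
    refine (((hg x).div_const (√lam)).arctan.div_const _).congr_deriv ?_
    have : 0 < lam + g x ^ 2 := by positivity
    field_simp
    rw [hss]; field_simp; ring
  have hgqc : Continuous fun x => g' x / (g x ^ 2 + lam) :=
    hg'.div ((hgc.pow 2).add continuous_const) (fun x => (hpos x).ne')
  have hatI : ∫ x in a..b, g' x / (g x ^ 2 + lam) ≤ Real.pi / √lam := by
    rw [intervalIntegral.integral_eq_sub_of_hasDerivAt (fun x _ => hatan x)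
      (hgqc.intervalIntegrable _ _), ← sub_div]
    gcongr
    linarith [Real.arctan_lt_pi_div_two (g b / √lam), Real.neg_pi_div_two_lt_arctan (g a / √lam)]
  have e2 : ‖∫ x in a..b, Complex.exp (Complex.I * φ x) * ((lam * w x / (g x ^ 2 + lam) : ℝ) : ℂ)‖
      ≤ Real.pi / √lam := by
    refine le_trans (intervalIntegral.norm_integral_le_of_norm_le hab ?_ (hgqc.intervalIntegrable _ _)) hatI
    refine Filter.Eventually.of_forall fun x hx => ?_
    have hx' : x ∈ Set.Icc a b := ⟨hx.1.le, hx.2⟩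
    rw [norm_mul, hne, one_mul, Complex.norm_real, Real.norm_of_nonneg
      (div_nonneg (mul_nonneg hlam.le (hw0 x hx')) (hpos x).le)]
    have := hpos x
    gcongr
    exact hconv x hx'
  have e3 : ‖∫ x in a..b, Complex.I * (Complex.exp (Complex.I * φ x) * (k' x : ℂ))‖ ≤ Real.pi / √lam := by
    refine le_trans (intervalIntegral.norm_integral_le_of_norm_le hab ?_ (hgqc.intervalIntegrable _ _)) hatI
    refine Filter.Eventually.of_forall fun x hx => ?_
    have hx' : x ∈ Set.Icc a b := ⟨hx.1.le, hx.2⟩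
    have hg0 : 0 ≤ g' x := (mul_nonneg hlam.le (hw0 x hx')).trans (hconv x hx')
    rw [norm_mul, norm_mul, hne, Complex.norm_I, one_mul, one_mul, Complex.norm_real]
    simp only [hk']
    rw [norm_div, norm_mul, Real.norm_of_nonneg hg0, Real.norm_eq_abs, norm_pow,
      Real.norm_of_nonneg (hpos x).le, div_le_div_iff₀ (pow_pos (hpos x) 2) (hpos x)]
    have : |lam - g x ^ 2| ≤ g x ^ 2 + lam := by
      rw [abs_le]; constructor <;> nlinarith [sq_nonneg (g x)]
    calc g' x * |lam - g x ^ 2| * (g x ^ 2 + lam) ≤ g' x * (g x ^ 2 + lam) * (g x ^ 2 + lam) := by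
          have := hpos x
          gcongr
      _ = _ := by ring
  have e1 : ∀ x, ‖-Complex.I * (Complex.exp (Complex.I * φ x) * (k x : ℂ))‖ ≤ 1 / (2 * √lam) := fun x => by
    rw [norm_mul, norm_mul, hne, norm_neg, Complex.norm_I, one_mul, one_mul, Complex.norm_real]
    simp only [hk]
    rw [norm_div, Real.norm_of_nonneg (hpos x).le, Real.norm_eq_abs,
      div_le_div_iff₀ (hpos x) (by positivity)]
    nlinarith [sq_nonneg (|g x| - √lam), sq_abs (g x)]
  have e : ∫ x in a..b, Complex.exp (Complex.I * φ x) * w x =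
      (-Complex.I * (Complex.exp (Complex.I * φ b) * (k b : ℂ)) -
      -Complex.I * (Complex.exp (Complex.I * φ a) * (k a : ℂ))) +
      (∫ x in a..b, Complex.exp (Complex.I * φ x) * ((lam * w x / (g x ^ 2 + lam) : ℝ) : ℂ)) +
      ∫ x in a..b, Complex.I * (Complex.exp (Complex.I * φ x) * (k' x : ℂ)) := by
    rw [← key]; ring
  rw [e]
  calc _ ≤ (1 / (2 * √lam) + 1 / (2 * √lam)) + Real.pi / √lam + Real.pi / √lam := by
        refine (norm_add_le _ _).trans (add_le_add ((norm_add_le _ _).trans (add_le_add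
          ((norm_sub_le _ _).trans (add_le_add (e1 b) (e1 a))) e2)) e3)
    _ = (1 + 2 * Real.pi) / √lam := by field_simp; ring
    _ ≤ 8 / √lam := by gcongr; linarith [Real.pi_lt_d2]

/-- One integration by parts in `∫ e^{iφ} w` where the phase is not stationary; `k'` is the derivative
of `w / φ'`. -/
theorem norm_integral_exp_mul_le_of_deriv_ne_zero {φ φ' w k' K : ℝ → ℝ} {a b : ℝ} (hab : a ≤ b)
    (hφ : ∀ x, HasDerivAt φ (φ' x) x) (hφ'c : Continuous φ') (h0 : ∀ x ∈ Set.Icc a b, φ' x ≠ 0)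
    (hk : ∀ x ∈ Set.Icc a b, HasDerivAt (fun x => w x / φ' x) (k' x) x)
    (hk'c : ContinuousOn k' (Set.Icc a b))
    (hK : IntervalIntegrable K volume a b) (hkK : ∀ x ∈ Set.Ioc a b, |k' x| ≤ K x) :
    ‖∫ x in a..b, Complex.exp (Complex.I * φ x) * w x‖ ≤
      |w a / φ' a| + |w b / φ' b| + ∫ x in a..b, K x := by
  have hu : Set.uIcc a b = Set.Icc a b := Set.uIcc_of_le hab
  have hφc : Continuous φ := continuous_iff_continuousAt.2 fun x => (hφ x).continuousAt
  have hec : Continuous (fun x : ℝ => Complex.exp (Complex.I * φ x)) := by fun_prop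
  have hne : ∀ x, ‖Complex.exp (Complex.I * φ x)‖ = 1 := fun x => by
    rw [mul_comm]; exact Complex.norm_exp_ofReal_mul_I _
  have hed : ∀ x, HasDerivAt (fun x : ℝ => Complex.exp (Complex.I * φ x))
      (Complex.exp (Complex.I * φ x) * (Complex.I * (φ' x : ℂ))) x := fun x =>
    (((hφ x).ofReal_comp).const_mul Complex.I).cexp
  have ibp := intervalIntegral.integral_mul_deriv_eq_deriv_mul (a := a) (b := b)
    (u := fun x => ((w x / φ' x : ℝ) : ℂ)) (u' := fun x => (k' x : ℂ))
    (v := fun x => Complex.exp (Complex.I * φ x))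
    (v' := fun x => Complex.exp (Complex.I * φ x) * (Complex.I * (φ' x : ℂ)))
    (fun x hx => (hk x (hu ▸ hx)).ofReal_comp) (fun x _ => hed x)
    ((Complex.continuous_ofReal.comp_continuousOn (hu ▸ hk'c)).intervalIntegrable)
    ((hec.mul (continuous_const.mul (Complex.continuous_ofReal.comp hφ'c))).intervalIntegrable _ _)
  have e : ∫ x in a..b, Complex.exp (Complex.I * φ x) * w x = -Complex.I *
      ∫ x in a..b, ((w x / φ' x : ℝ) : ℂ) * (Complex.exp (Complex.I * φ x) * (Complex.I * (φ' x : ℂ))) := by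
    rw [← intervalIntegral.integral_const_mul]
    refine intervalIntegral.integral_congr fun x hx => ?_
    have : (φ' x : ℂ) ≠ 0 := Complex.ofReal_ne_zero.2 (h0 x (hu ▸ hx))
    simp only [Complex.ofReal_div]
    field_simp
    linear_combination (w x : ℂ) * Complex.I_sq
  rw [e, norm_mul, norm_neg, Complex.norm_I, one_mul, ibp]
  refine (norm_sub_le _ _).trans (add_le_add ((norm_sub_le _ _).trans ?_) ?_)
  · rw [norm_mul, norm_mul, hne, hne, mul_one, mul_one, Complex.norm_real, Complex.norm_real, add_comm]
    rfl
  · refine intervalIntegral.norm_integral_le_of_norm_le hab ?_ hK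
    refine Filter.Eventually.of_forall fun x hx => ?_
    rw [norm_mul, hne, mul_one, Complex.norm_real]
    exact hkK x hx

/-! ### The model phase in one dimension -/

/-- The one-dimensional Japanese bracket `⟨η⟩ = (1 + η²)^{1/2}`. -/
noncomputable def bracket (η : ℝ) : ℝ := √(1 + η ^ 2)

theorem bracket_sq (η : ℝ) : bracket η ^ 2 = 1 + η ^ 2 := Real.sq_sqrt (by positivity)

theorem one_le_bracket (η : ℝ) : 1 ≤ bracket η :=
  Real.one_le_sqrt.2 (by nlinarith [sq_nonneg η])

theorem bracket_pos (η : ℝ) : 0 < bracket η := one_pos.trans_le (one_le_bracket η)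

theorem bracket_neg (η : ℝ) : bracket (-η) = bracket η := by simp [bracket]

theorem abs_le_bracket (η : ℝ) : |η| ≤ bracket η :=
  Real.abs_le_sqrt (by nlinarith)

theorem hasDerivAt_bracket (η : ℝ) : HasDerivAt bracket (η / bracket η) η := by
  have h : HasDerivAt (fun η : ℝ => 1 + η ^ 2) (2 * η) η := by
    simpa using (hasDerivAt_pow 2 η).const_add 1
  refine (h.sqrt (by positivity)).congr_deriv ?_
  rw [bracket]; field_simp

theorem continuous_bracket : Continuous bracket := by unfold bracket; fun_prop

theorem bracket_mono {a b : ℝ} (ha : 0 ≤ a) (hab : a ≤ b) : bracket a ≤ bracket b :=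
  Real.sqrt_le_sqrt (by nlinarith)

theorem bracket_rpow (η : ℝ) : bracket η ^ (-(3 / 2) : ℝ) = 1 / √(bracket η) ^ 3 := by
  rw [Real.rpow_neg (bracket_pos η).le, Real.sqrt_eq_rpow, ← Real.rpow_natCast, ← Real.rpow_mul (bracket_pos η).le]
  norm_num

/-- The phase `Xη + t⟨η⟩ - 2κ log ⟨η⟩`. -/
noncomputable def kgPhase (κ X t η : ℝ) : ℝ := X * η + t * bracket η - 2 * κ * Real.log (bracket η)

/-- The derivative in `η` of `kgPhase`. -/
noncomputable def kgPhaseDeriv (κ X t η : ℝ) : ℝ :=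
  X + t * (η / bracket η) - 2 * κ * (η / bracket η ^ 2)

/-- The second derivative in `η` of `kgPhase`; the linear term has disappeared. -/
noncomputable def kgPhaseDeriv2 (κ t η : ℝ) : ℝ :=
  t / bracket η ^ 3 - 2 * κ * ((1 - η ^ 2) / bracket η ^ 4)

theorem hasDerivAt_kgPhase (κ X t η : ℝ) :
    HasDerivAt (kgPhase κ X t) (kgPhaseDeriv κ X t η) η := by
  have h := hasDerivAt_bracket η
  refine ((((hasDerivAt_id η).const_mul X).add (h.const_mul t)).sub
    ((h.log (bracket_pos η).ne').const_mul (2 * κ))).congr_deriv ?_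
  have := bracket_pos η
  simp only [kgPhaseDeriv]
  field_simp

theorem hasDerivAt_kgPhaseDeriv (κ X t η : ℝ) :
    HasDerivAt (kgPhaseDeriv κ X t) (kgPhaseDeriv2 κ t η) η := by
  have h := hasDerivAt_bracket η
  have hp := bracket_pos η
  have h1 := (hasDerivAt_id η).div h hp.ne'
  have h2 := (hasDerivAt_id η).div (h.pow 2) (pow_ne_zero 2 hp.ne')
  refine (((hasDerivAt_const η X).add (h1.const_mul t)).sub (h2.const_mul (2 * κ))).congr_deriv ?_
  have hs := bracket_sq η
  simp only [kgPhaseDeriv2, id, Pi.pow_apply]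
  have hs2 : η ^ 2 = bracket η ^ 2 - 1 := by linarith
  field_simp
  norm_num
  rw [hs2]
  ring

theorem continuous_kgPhaseDeriv (κ X t : ℝ) : Continuous (kgPhaseDeriv κ X t) :=
  continuous_iff_continuousAt.2 fun x => (hasDerivAt_kgPhaseDeriv κ X t x).continuousAt

theorem continuous_kgPhaseDeriv2 (κ t : ℝ) : Continuous (kgPhaseDeriv2 κ t) := by
  have h := fun η => (bracket_pos η).ne'
  have hc := continuous_bracket
  unfold kgPhaseDeriv2
  exact (continuous_const.div (hc.pow 3) fun η => pow_ne_zero _ (h η)).sub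
    (continuous_const.mul ((continuous_const.sub (continuous_id.pow 2)).div (hc.pow 4)
      fun η => pow_ne_zero _ (h η)))

theorem hasDerivAt_sqrt_bracket (η : ℝ) :
    HasDerivAt (fun η => √(bracket η)) (η / (2 * √(bracket η) ^ 3)) η := by
  refine ((hasDerivAt_bracket η).sqrt (bracket_pos η).ne').congr_deriv ?_
  have h := Real.sqrt_pos.2 (bracket_pos η)
  have h2 := Real.sq_sqrt (bracket_pos η).le
  nth_rw 1 [← h2]
  field_simp

/-- For `X ≥ -t` the phase may be stationary, but in the variable `∫ ⟨η⟩^{-3/2} dη` it is uniformly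
convex: its second derivative is at least `t / 8`. The term `κ log ⟨η⟩` is harmless below the frequency
`t / (16 (1 + |κ|))`. -/
theorem norm_integral_kgPhase_le_of_neg_le {κ X t s : ℝ} (hs : 0 ≤ s) (ht : 0 < t) (hX : -t ≤ X)
    (hst : 16 * (1 + |κ|) * bracket s ≤ t) :
    ‖∫ η in (0 : ℝ)..s, Complex.exp (Complex.I * kgPhase κ X t η) *
      ((bracket η ^ (-(3 / 2) : ℝ) : ℝ) : ℂ)‖ ≤ 100 / √t := by
  have hq : ∀ η, 0 < √(bracket η) := fun η => Real.sqrt_pos.2 (bracket_pos η)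
  have hqq : ∀ η, √(bracket η) ^ 2 = bracket η := fun η => Real.sq_sqrt (bracket_pos η).le
  have hcb := continuous_bracket
  simp only [bracket_rpow]
  refine (norm_integral_exp_mul_le_of_weighted_convex (lam := t / 8)
    (g := fun η => kgPhaseDeriv κ X t η * √(bracket η) ^ 3)
    (g' := fun η => kgPhaseDeriv2 κ t η * √(bracket η) ^ 3 +
      kgPhaseDeriv κ X t η * (3 / 2 * η / √(bracket η))) hs (by positivity) ?_ ?_ ?_ ?_ ?_ ?_).trans ?_
  · exact continuous_const.div (hcb.sqrt.pow 3) fun η => pow_ne_zero _ (hq η).ne'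
  · exact ((continuous_kgPhaseDeriv2 κ t).mul (hcb.sqrt.pow 3)).add
      ((continuous_kgPhaseDeriv κ X t).mul ((continuous_const.mul continuous_id).div hcb.sqrt
        fun η => (hq η).ne'))
  · intro η
    refine (hasDerivAt_kgPhase κ X t η).congr_deriv ?_
    have := hq η
    field_simp
  · intro η
    refine ((hasDerivAt_kgPhaseDeriv κ X t η).mul ((hasDerivAt_sqrt_bracket η).pow 3)).congr_deriv ?_
    have := hq η
    simp only [Pi.pow_apply]
    field_simp
    norm_num
    ring
  · intro η _
    have := hq η
    positivity
  · intro η hη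
    have h1 := hq η
    have hj := bracket_pos η
    have hj1 := one_le_bracket η
    have hjs := bracket_sq η
    have hκ : 2 * |κ| * bracket η ≤ t / 8 := by
      have := bracket_mono hη.1 hη.2
      nlinarith [abs_nonneg κ, bracket_pos s]
    have e : kgPhaseDeriv2 κ t η * √(bracket η) ^ 3 +
        kgPhaseDeriv κ X t η * (3 / 2 * η / √(bracket η)) =
        (t + 3 / 2 * (X * (η * bracket η) + t * η ^ 2) - 2 * κ * ((1 + η ^ 2 / 2) / bracket η)) *
          (1 / √(bracket η) ^ 3) := by
      rw [kgPhaseDeriv, kgPhaseDeriv2]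
      have hb := (hqq η).symm
      set q := √(bracket η)
      clear_value q
      rw [hb]
      field_simp
      ring
    simp only [e]
    refine mul_le_mul_of_nonneg_right ?_ (by positivity)
    -- `η⟨η⟩ ≤ η² + 1/2`, so the convexity is at least `t - 3t/4` up to the term with `κ`
    have a1 : X * (η * bracket η) ≥ -t * (η * bracket η) :=
      mul_le_mul_of_nonneg_right hX (mul_nonneg hη.1 hj.le)
    have a2 : η * bracket η ≤ η ^ 2 + 1 / 2 := by nlinarith [sq_nonneg (η - bracket η)]
    have a3 : (1 + η ^ 2 / 2) / bracket η ≤ bracket η := by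
      rw [div_le_iff₀ hj]; nlinarith [sq_nonneg η]
    have a4 : 2 * κ * ((1 + η ^ 2 / 2) / bracket η) ≤ 2 * |κ| * bracket η := by
      have : 0 ≤ (1 + η ^ 2 / 2) / bracket η := by positivity
      have := le_abs_self κ
      gcongr
    nlinarith
  · rw [div_le_div_iff₀ (Real.sqrt_pos.2 (by positivity)) (Real.sqrt_pos.2 ht)]
    have : √t ≤ 3 * √(t / 8) := by
      rw [Real.sqrt_le_left (by positivity), mul_pow, Real.sq_sqrt (by positivity)]
      linarith
    have := Real.sqrt_nonneg (t / 8)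
    linarith

/-- For `X < -t` the phase is not stationary: its derivative has size at least `t ⟨η⟩^{-2} / 4`, which
suffices for a single integration by parts. -/
theorem norm_integral_kgPhase_le_of_lt_neg {κ X t s : ℝ} (hs : 0 ≤ s) (ht : 0 < t) (hX : X < -t)
    (hst : 16 * (1 + |κ|) * bracket s ≤ t) :
    ‖∫ η in (0 : ℝ)..s, Complex.exp (Complex.I * kgPhase κ X t η) *
      ((bracket η ^ (-(3 / 2) : ℝ) : ℝ) : ℂ)‖ ≤ 100 / √t := by
  have hq : ∀ η, 0 < √(bracket η) := fun η => Real.sqrt_pos.2 (bracket_pos η)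
  have hqq : ∀ η, √(bracket η) ^ 2 = bracket η := fun η => Real.sq_sqrt (bracket_pos η).le
  have hcb := continuous_bracket
  have hκj : ∀ η ∈ Set.Icc 0 s, 16 * (1 + |κ|) * bracket η ≤ t := fun η hη =>
    (mul_le_mul_of_nonneg_left (bracket_mono hη.1 hη.2) (by positivity)).trans hst
  have hlow : ∀ η ∈ Set.Icc 0 s, t / (4 * bracket η ^ 2) ≤ -kgPhaseDeriv κ X t η := fun η hη => by
    have hj := bracket_pos η
    have hj1 := one_le_bracket η
    have hjs := bracket_sq η
    have h1 := hκj η hη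
    have a1 : η / bracket η ≤ 1 - 1 / (2 * bracket η ^ 2) := by
      rw [div_le_iff₀ hj, sub_mul, one_mul, ← sub_nonneg]
      have : bracket η - 1 / (2 * bracket η ^ 2) * bracket η - η =
        (bracket η - η) ^ 2 / (2 * bracket η) := by
        have : (bracket η - η) ^ 2 = 2 * bracket η ^ 2 - 1 - 2 * η * bracket η := by nlinarith
        rw [this]; field_simp
      rw [this]; positivity
    have a2 : |2 * κ * (η / bracket η ^ 2)| ≤ t / (8 * bracket η ^ 2) := by
      rw [abs_mul, abs_div, abs_mul, abs_two, abs_of_nonneg hη.1, abs_of_pos (pow_pos hj 2), ← mul_div_assoc,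
        div_le_div_iff₀ (by positivity) (by positivity)]
      have : η ≤ bracket η := (le_abs_self η).trans (abs_le_bracket η)
      have : 2 * |κ| * η * 8 ≤ t := by
        calc 2 * |κ| * η * 8 ≤ 2 * |κ| * bracket η * 8 := by gcongr
          _ ≤ t := by nlinarith
      nlinarith [pow_pos hj 2]
    have a3 := neg_abs_le (2 * κ * (η / bracket η ^ 2))
    have a4 : t * (η / bracket η) ≤ t - t / (2 * bracket η ^ 2) := by
      calc _ ≤ t * (1 - 1 / (2 * bracket η ^ 2)) := by gcongr
        _ = _ := by ring
    have a5 : t / (4 * bracket η ^ 2) + t / (8 * bracket η ^ 2) ≤ t / (2 * bracket η ^ 2) := by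
      rw [← sub_nonneg]
      have : t / (2 * bracket η ^ 2) - (t / (4 * bracket η ^ 2) + t / (8 * bracket η ^ 2)) =
        t / (8 * bracket η ^ 2) := by field_simp; ring
      rw [this]; positivity
    rw [kgPhaseDeriv]
    linarith
  have hneg : ∀ η ∈ Set.Icc 0 s, kgPhaseDeriv κ X t η < 0 := fun η hη => by
    have := hlow η hη
    have : 0 < t / (4 * bracket η ^ 2) := by have := bracket_pos η; positivity
    linarith
  have habs : ∀ η ∈ Set.Icc 0 s, |1 / √(bracket η) ^ 3 / kgPhaseDeriv κ X t η| ≤ 4 / √t := fun η hη => by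
    have h1 := hq η
    have h2 := hlow η hη
    have hj := bracket_pos η
    have h3 : √(bracket η) ≤ √t := Real.sqrt_le_sqrt (by nlinarith [hκj η hη, abs_nonneg κ])
    have ht' := Real.sqrt_pos.2 ht
    rw [abs_div, abs_of_pos (by positivity), abs_of_neg (hneg η hη)]
    calc 1 / √(bracket η) ^ 3 / -kgPhaseDeriv κ X t η ≤ 1 / √(bracket η) ^ 3 / (t / (4 * bracket η ^ 2)) := by
          gcongr
      _ = 4 * √(bracket η) / t := by
          rw [← hqq η]; field_simp
          rw [Real.sqrt_sq h1.le]
      _ ≤ 4 * √t / t := by gcongr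
      _ = 4 / √t := by
          nth_rw 2 [← Real.sq_sqrt ht.le]
          field_simp
  simp only [bracket_rpow]
  set k' : ℝ → ℝ := fun η => (-(3 / 2 * η / √(bracket η) ^ 7) * kgPhaseDeriv κ X t η -
    1 / √(bracket η) ^ 3 * kgPhaseDeriv2 κ t η) / kgPhaseDeriv κ X t η ^ 2 with hk'
  have hKi : IntervalIntegrable (fun η : ℝ => 38 / t * η ^ (-(1 / 2) : ℝ)) volume 0 s :=
    (intervalIntegral.intervalIntegrable_rpow' (by norm_num)).const_mul _
  have main := norm_integral_exp_mul_le_of_deriv_ne_zero (w := fun η => 1 / √(bracket η) ^ 3) (k' := k') hs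
    (hasDerivAt_kgPhase κ X t) (continuous_kgPhaseDeriv κ X t) (fun η hη => (hneg η hη).ne)
    (fun η hη => ?_) ?_ hKi ?_
  · refine main.trans ?_
    have h1 := habs 0 ⟨le_rfl, hs⟩
    have h2 := habs s ⟨hs, le_rfl⟩
    have h3 : ∫ η in (0 : ℝ)..s, 38 / t * η ^ (-(1 / 2) : ℝ) ≤ 76 / √t := by
      rw [intervalIntegral.integral_const_mul, integral_rpow (Or.inl (by norm_num))]
      norm_num
      rw [← Real.sqrt_eq_rpow]
      have : √s ≤ √t := Real.sqrt_le_sqrt (by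
        nlinarith [(le_abs_self s).trans (abs_le_bracket s), abs_nonneg κ, bracket_pos s])
      calc 38 / t * (√s / (1 / 2)) ≤ 38 / t * (√t / (1 / 2)) := by gcongr
        _ = 76 / √t := by
          have := Real.sqrt_pos.2 ht
          nth_rw 1 [← Real.sq_sqrt ht.le]
          field_simp; norm_num
    calc _ ≤ 4 / √t + 4 / √t + 76 / √t := add_le_add (add_le_add h1 h2) h3
      _ = 84 / √t := by ring
      _ ≤ 100 / √t := by gcongr; norm_num
  · have h1 := hq η
    refine (((hasDerivAt_const η (1 : ℝ)).div ((hasDerivAt_sqrt_bracket η).pow 3)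
      (pow_ne_zero 3 h1.ne')).div (hasDerivAt_kgPhaseDeriv κ X t η) (hneg η hη).ne).congr_deriv ?_
    simp only [hk', Pi.pow_apply]
    congr 1
    simp only [Pi.div_apply, Pi.pow_apply]
    field_simp
    norm_num
    ring
  · have hd : ∀ η ∈ Set.Icc 0 s, kgPhaseDeriv κ X t η ^ 2 ≠ 0 := fun η hη => pow_ne_zero 2 (hneg η hη).ne
    refine ContinuousOn.div (Continuous.continuousOn ?_)
      ((continuous_kgPhaseDeriv κ X t).pow 2).continuousOn hd
    exact (((continuous_const.mul continuous_id).div (hcb.sqrt.pow 7) fun η => pow_ne_zero _ (hq η).ne').neg.mul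
      (continuous_kgPhaseDeriv κ X t)).sub ((continuous_const.div (hcb.sqrt.pow 3)
        fun η => pow_ne_zero _ (hq η).ne').mul (continuous_kgPhaseDeriv2 κ t))
  · intro η hη
    have hη' : η ∈ Set.Icc 0 s := ⟨hη.1.le, hη.2⟩
    have h1 := hq η
    have hj := bracket_pos η
    have hj1 := one_le_bracket η
    have hl := hlow η hη'
    have hη0 : 0 < η := hη.1
    have hjη : η ≤ bracket η := (le_abs_self η).trans (abs_le_bracket η)
    have hjs := bracket_sq η
    set D := kgPhaseDeriv κ X t η
    have hD : 0 < -D := by have := hneg η hη'; simp only [D]; linarith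
    set P := -D with hP
    have hDP : D = -P := by simp [hP]
    have b2 : |kgPhaseDeriv2 κ t η| ≤ 2 * t / bracket η ^ 3 := by
      rw [kgPhaseDeriv2]
      have : |2 * κ * ((1 - η ^ 2) / bracket η ^ 4)| ≤ t / bracket η ^ 3 := by
        rw [abs_mul, abs_div, abs_mul, abs_two, abs_of_pos (pow_pos hj 4), ← mul_div_assoc,
          div_le_div_iff₀ (by positivity) (by positivity)]
        have c1 : |1 - η ^ 2| ≤ bracket η ^ 2 := by rw [abs_le]; constructor <;> nlinarith
        have c2 := hκj η hη'
        calc 2 * |κ| * |1 - η ^ 2| * bracket η ^ 3 ≤ 2 * |κ| * bracket η ^ 2 * bracket η ^ 3 := by gcongr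
          _ = (2 * |κ| * bracket η) * bracket η ^ 4 := by ring
          _ ≤ t * bracket η ^ 4 := by gcongr; nlinarith
      calc _ ≤ |t / bracket η ^ 3| + |2 * κ * ((1 - η ^ 2) / bracket η ^ 4)| := abs_sub _ _
        _ ≤ t / bracket η ^ 3 + t / bracket η ^ 3 := by
            rw [abs_of_pos (by positivity : 0 < t / bracket η ^ 3)]; gcongr
        _ = _ := by ring
    have e : |k' η| ≤ 3 / 2 * η / √(bracket η) ^ 7 / P + 1 / √(bracket η) ^ 3 * |kgPhaseDeriv2 κ t η| / P ^ 2 := by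
      have : k' η = 3 / 2 * η / √(bracket η) ^ 7 / P + -(1 / √(bracket η) ^ 3 * kgPhaseDeriv2 κ t η / P ^ 2) := by
        simp only [hk']
        change (_ * D - _) / D ^ 2 = _
        rw [hDP]
        field_simp
        ring
      rw [this]
      refine (abs_add_le _ _).trans (add_le_add (le_of_eq (abs_of_pos (by positivity))) (le_of_eq ?_))
      rw [abs_neg, abs_div, abs_mul, abs_of_pos (by positivity : 0 < 1 / √(bracket η) ^ 3), abs_of_pos (pow_pos hD 2)]
    have f1 : 3 / 2 * η / √(bracket η) ^ 7 / P ≤ 6 / (t * √(bracket η)) := by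
      calc _ ≤ 3 / 2 * bracket η / √(bracket η) ^ 7 / (t / (4 * bracket η ^ 2)) := by gcongr
        _ = 6 / (t * √(bracket η)) := by
          rw [← hqq η]; field_simp; rw [Real.sqrt_sq h1.le]; ring
    have f2 : 1 / √(bracket η) ^ 3 * |kgPhaseDeriv2 κ t η| / P ^ 2 ≤ 32 / (t * √(bracket η)) := by
      calc _ ≤ 1 / √(bracket η) ^ 3 * (2 * t / bracket η ^ 3) / (t / (4 * bracket η ^ 2)) ^ 2 := by gcongr
        _ = 32 / (t * √(bracket η)) := by
          rw [← hqq η]; field_simp; rw [Real.sqrt_sq h1.le]; ring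
    have f3 : 1 / √(bracket η) ≤ η ^ (-(1 / 2) : ℝ) := by
      rw [Real.rpow_neg hη0.le, ← Real.sqrt_eq_rpow, ← one_div]
      have := Real.sqrt_pos.2 hη0
      gcongr
    calc _ ≤ _ := e
      _ ≤ 6 / (t * √(bracket η)) + 32 / (t * √(bracket η)) := add_le_add f1 f2
      _ = 38 / t * (1 / √(bracket η)) := by field_simp; norm_num
      _ ≤ _ := by gcongr

/-- Uniform decay of the model oscillatory integral over `[0, s]`, for either sign of `t`. -/
theorem norm_integral_kgPhase_le {κ X t s : ℝ} (hs : 0 ≤ s) (ht : t ≠ 0)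
    (hst : 16 * (1 + |κ|) * bracket s ≤ |t|) :
    ‖∫ η in (0 : ℝ)..s, Complex.exp (Complex.I * kgPhase κ X t η) *
      ((bracket η ^ (-(3 / 2) : ℝ) : ℝ) : ℂ)‖ ≤ 100 / √|t| := by
  have pos : ∀ κ X t : ℝ, 0 < t → 16 * (1 + |κ|) * bracket s ≤ t →
    ‖∫ η in (0 : ℝ)..s, Complex.exp (Complex.I * kgPhase κ X t η) *
      ((bracket η ^ (-(3 / 2) : ℝ) : ℝ) : ℂ)‖ ≤ 100 / √t := fun κ X t ht h => by
    rcases le_or_gt (-t) X with hX | hX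
    · exact norm_integral_kgPhase_le_of_neg_le hs ht hX h
    · exact norm_integral_kgPhase_le_of_lt_neg hs ht hX h
  rcases lt_or_gt_of_ne ht with h | h
  · rw [abs_of_neg h] at hst ⊢
    have := pos (-κ) (-X) (-t) (by linarith) (by rwa [abs_neg])
    refine le_of_eq_of_le ?_ this
    rw [← Complex.norm_conj, intervalIntegral.intervalIntegral_eq_integral_uIoc,
      intervalIntegral.intervalIntegral_eq_integral_uIoc]
    simp only [if_pos hs, one_smul]
    rw [← integral_conj]
    congr 1
    refine integral_congr_ae (Filter.Eventually.of_forall fun η => ?_)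
    simp only [map_mul, ← Complex.exp_conj, Complex.conj_I, Complex.conj_ofReal]
    congr 2
    simp only [kgPhase]
    push_cast
    ring
  · rw [abs_of_pos h] at hst ⊢
    exact pos κ X t h hst

/-! ### The one-dimensional oscillatory integral with a slowly varying factor -/

/-- The rotated time `δ - i t`, with damping `δ`. -/
noncomputable def dampedTime (δ t : ℝ) : ℂ := (δ : ℂ) - Complex.I * (t : ℂ)

theorem dampedTime_re (δ t : ℝ) : (dampedTime δ t).re = δ := by simp [dampedTime]

theorem dampedTime_im (δ t : ℝ) : (dampedTime δ t).im = -t := by simp [dampedTime]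

theorem abs_le_norm_dampedTime (δ t : ℝ) : |t| ≤ ‖dampedTime δ t‖ := by
  have := Complex.abs_im_le_norm (dampedTime δ t)
  rwa [dampedTime_im, abs_neg] at this

theorem integrable_bracket_rpow : Integrable fun η : ℝ => bracket η ^ (-(3 / 2) : ℝ) := by
  have h := integrable_rpow_neg_one_add_norm_sq (E := ℝ) (μ := volume) (r := 3 / 2) (by norm_num)
  refine h.congr (Filter.Eventually.of_forall fun η => ?_)
  simp only [bracket]
  rw [Real.sqrt_eq_rpow, ← Real.rpow_mul (by positivity), Real.norm_eq_abs, sq_abs]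
  norm_num

theorem continuous_bracket_rpow : Continuous fun η : ℝ => bracket η ^ (-(3 / 2) : ℝ) :=
  continuous_bracket.rpow_const fun η => Or.inl (bracket_pos η).ne'

/-- The integrand `e^{iXη - (δ - it)⟨η⟩} ⟨η⟩^{-3/2 - 2iκ} b((δ - it)⟨η⟩)`, with the pure phase separated
from the damping and the slowly varying factor `b`. -/
noncomputable def modelIntegrand (κ X δ t : ℝ) (b : ℂ → ℂ) (η : ℝ) : ℂ :=
  Complex.exp (Complex.I * kgPhase κ X t η) * ((bracket η ^ (-(3 / 2) : ℝ) : ℝ) : ℂ) *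
    (((Real.exp (-(δ * bracket η)) : ℝ) : ℂ) * b (dampedTime δ t * bracket η))

theorem modelIntegrand_neg (κ X δ t : ℝ) (b : ℂ → ℂ) (η : ℝ) :
    modelIntegrand κ X δ t b (-η) = modelIntegrand κ (-X) δ t b η := by
  simp [modelIntegrand, kgPhase, bracket_neg]

section model
variable {b : ℂ → ℂ} {δ t M : ℝ}

theorem dampedTime_mul_bracket_re_pos (hδ : 0 < δ) (t η : ℝ) : 0 < (dampedTime δ t * bracket η).re := by
  rw [Complex.re_mul_ofReal, dampedTime_re]
  exact mul_pos hδ (bracket_pos η)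

theorem norm_modelIntegrand_le (hδ : 0 < δ) (hbM : ∀ z : ℂ, 0 < z.re → ‖b z‖ ≤ M) (κ X η : ℝ) :
    ‖modelIntegrand κ X δ t b η‖ ≤ M * bracket η ^ (-(3 / 2) : ℝ) := by
  have h1 : ‖Complex.exp (Complex.I * kgPhase κ X t η)‖ = 1 := by
    rw [mul_comm]; exact Complex.norm_exp_ofReal_mul_I _
  have h2 := Real.rpow_nonneg (bracket_pos η).le (-(3 / 2))
  have h3 := hbM _ (dampedTime_mul_bracket_re_pos hδ t η)
  have h4 : Real.exp (-(δ * bracket η)) ≤ 1 := Real.exp_le_one_iff.2 (by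
    have := bracket_pos η; simp only [Left.neg_nonpos_iff]; positivity)
  rw [modelIntegrand, norm_mul, norm_mul, norm_mul, h1, one_mul, Complex.norm_real, Complex.norm_real,
    Real.norm_of_nonneg h2, Real.norm_of_nonneg (Real.exp_pos _).le, mul_comm]
  refine mul_le_mul_of_nonneg_right ?_ h2
  calc _ ≤ 1 * ‖b (dampedTime δ t * bracket η)‖ := by gcongr
    _ ≤ M := by rwa [one_mul]

theorem continuous_modelIntegrand (hδ : 0 < δ) (hb : DifferentiableOn ℂ b {z | 0 < z.re}) (κ X : ℝ) :
    Continuous (modelIntegrand κ X δ t b) := by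
  have hφ : Continuous (kgPhase κ X t) :=
    continuous_iff_continuousAt.2 fun x => (hasDerivAt_kgPhase κ X t x).continuousAt
  have hj := continuous_bracket
  have h2 : Continuous fun η : ℝ => b (dampedTime δ t * bracket η) :=
    hb.continuousOn.comp_continuous (by fun_prop) (dampedTime_mul_bracket_re_pos hδ t)
  have h3 := continuous_bracket_rpow
  unfold modelIntegrand
  exact ((Complex.continuous_exp.comp (continuous_const.mul (Complex.continuous_ofReal.comp hφ))).mul
    (Complex.continuous_ofReal.comp h3)).mul ((Complex.continuous_ofReal.comp (by fun_prop)).mul h2)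

theorem integrable_modelIntegrand (hδ : 0 < δ) (hb : DifferentiableOn ℂ b {z | 0 < z.re})
    (hbM : ∀ z : ℂ, 0 < z.re → ‖b z‖ ≤ M) (κ X : ℝ) : Integrable (modelIntegrand κ X δ t b) :=
  (integrable_bracket_rpow.const_mul M).mono' (continuous_modelIntegrand hδ hb κ X).aestronglyMeasurable
    (Filter.Eventually.of_forall (norm_modelIntegrand_le hδ hbM κ X))

/-- Low frequencies: the factor multiplying the pure oscillation has bounded variation, uniformly in
the damping. -/
theorem norm_integral_modelIntegrand_zero_le (hδ : 0 < δ) (ht : 1 ≤ |t|)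
    (hb : DifferentiableOn ℂ b {z | 0 < z.re})
    (hbM : ∀ z : ℂ, 0 < z.re → ‖b z‖ ≤ M) (hbM' : ∀ z : ℂ, 0 < z.re → ‖deriv b z‖ ≤ M / ‖z‖ ^ 2)
    {κ X R : ℝ} (hR : 0 ≤ R) (hRt : 16 * (1 + |κ|) * bracket R ≤ |t|) :
    ‖∫ η in (0 : ℝ)..R, modelIntegrand κ X δ t b η‖ ≤ 400 * M / √|t| := by
  have ht0 : t ≠ 0 := by rintro rfl; norm_num at ht
  have hM : 0 ≤ M := (norm_nonneg _).trans (hbM 1 (by simp))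
  have hj := continuous_bracket
  have hopen : IsOpen {z : ℂ | 0 < z.re} := isOpen_lt continuous_const Complex.continuous_re
  have hre := dampedTime_mul_bracket_re_pos hδ t
  set ζ := dampedTime δ t with hζ
  set f : ℝ → ℂ := fun η => Complex.exp (Complex.I * kgPhase κ X t η) *
    ((bracket η ^ (-(3 / 2) : ℝ) : ℝ) : ℂ) with hf
  have hφ : Continuous (kgPhase κ X t) :=
    continuous_iff_continuousAt.2 fun x => (hasDerivAt_kgPhase κ X t x).continuousAt
  have hfc : Continuous f := (Complex.continuous_exp.comp
    (continuous_const.mul (Complex.continuous_ofReal.comp hφ))).mul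
      (Complex.continuous_ofReal.comp continuous_bracket_rpow)
  set A : ℝ → ℂ := fun η => ((Real.exp (-(δ * bracket η)) : ℝ) : ℂ) * b (ζ * bracket η) with hA
  set A' : ℝ → ℂ := fun η =>
    ((Real.exp (-(δ * bracket η)) * -(δ * (η / bracket η)) : ℝ) : ℂ) * b (ζ * bracket η) +
    ((Real.exp (-(δ * bracket η)) : ℝ) : ℂ) * (deriv b (ζ * bracket η) * (ζ * ((η / bracket η : ℝ) : ℂ))) with hA'
  have hbd : ∀ η : ℝ, HasDerivAt b (deriv b (ζ * bracket η)) (ζ * bracket η) := fun η =>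
    (hb.differentiableAt (hopen.mem_nhds (hre η))).hasDerivAt
  have hAd : ∀ η, HasDerivAt A (A' η) η := fun η => by
    have h1 := (((hasDerivAt_bracket η).const_mul δ).neg.exp).ofReal_comp
    have h2 : HasDerivAt (fun η : ℝ => b (ζ * bracket η))
        (deriv b (ζ * bracket η) * (ζ * ((η / bracket η : ℝ) : ℂ))) η :=
      (hbd η).comp η ((hasDerivAt_bracket η).ofReal_comp.const_mul ζ)
    exact h1.mul h2
  have hqc : Continuous fun η : ℝ => η / bracket η := continuous_id.div hj fun η => (bracket_pos η).ne'
  have hA'c : Continuous A' := by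
    have h1 : Continuous fun η : ℝ => b (ζ * bracket η) :=
      hb.continuousOn.comp_continuous (by fun_prop) hre
    have h2 : Continuous fun η : ℝ => deriv b (ζ * bracket η) :=
      (hb.deriv hopen).continuousOn.comp_continuous (by fun_prop) hre
    simp only [hA']
    exact ((Complex.continuous_ofReal.comp (by fun_prop)).mul h1).add
      ((Complex.continuous_ofReal.comp (by fun_prop)).mul
        (h2.mul (continuous_const.mul (Complex.continuous_ofReal.comp hqc))))
  set F : ℝ → ℂ := fun s => ∫ η in (0 : ℝ)..s, f η with hF
  have hFd : ∀ s, HasDerivAt F (f s) s := fun s =>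
    intervalIntegral.integral_hasDerivAt_right (hfc.intervalIntegrable _ _)
      (hfc.stronglyMeasurableAtFilter _ _) hfc.continuousAt
  have hFb : ∀ s ∈ Set.Icc 0 R, ‖F s‖ ≤ 100 / √|t| := fun s hs =>
    norm_integral_kgPhase_le hs.1 ht0
      ((mul_le_mul_of_nonneg_left (bracket_mono hs.1 hs.2) (by positivity)).trans hRt)
  have ibp := intervalIntegral.integral_mul_deriv_eq_deriv_mul (a := 0) (b := R)
    (fun x _ => hAd x) (fun x _ => hFd x) (hA'c.intervalIntegrable _ _) (hfc.intervalIntegrable _ _)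
  have e : ∫ η in (0 : ℝ)..R, modelIntegrand κ X δ t b η = ∫ η in (0 : ℝ)..R, A η * f η := by
    refine intervalIntegral.integral_congr fun η _ => ?_
    simp only [modelIntegrand, hA, hf, ← hζ]
    ring
  have hA_R : ‖A R‖ ≤ M := by
    have h4 : Real.exp (-(δ * bracket R)) ≤ 1 := Real.exp_le_one_iff.2 (by
      have := bracket_pos R; simp only [Left.neg_nonpos_iff]; positivity)
    simp only [hA]
    rw [norm_mul, Complex.norm_real, Real.norm_of_nonneg (Real.exp_pos _).le]
    calc _ ≤ 1 * ‖b (ζ * bracket R)‖ := by gcongr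
      _ ≤ M := by rw [one_mul]; exact hbM _ (hre R)
  set V : ℝ → ℝ := fun η => M * (δ * (η / bracket η) * Real.exp (-(δ * bracket η)) + 1 / (1 + η ^ 2)) with hV
  have hVd : ∀ η, HasDerivAt (fun η => M * (-Real.exp (-(δ * bracket η)) + Real.arctan η)) (V η) η := fun η => by
    have h1 := (((hasDerivAt_bracket η).const_mul δ).neg.exp).neg
    refine ((h1.add (Real.hasDerivAt_arctan η)).const_mul M).congr_deriv ?_
    simp only [hV, Pi.neg_apply]; ring
  have hVc : Continuous V := by
    simp only [hV]
    refine continuous_const.mul ((((continuous_const.mul hqc).mul (by fun_prop)).add ?_))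
    exact continuous_const.div (by fun_prop) fun η => by positivity
  have hVI : ∫ η in (0 : ℝ)..R, V η ≤ 3 * M := by
    rw [intervalIntegral.integral_eq_sub_of_hasDerivAt (fun η _ => hVd η) (hVc.intervalIntegrable _ _)]
    have h1 := Real.arctan_lt_pi_div_two R
    have h2 := Real.pi_lt_d2
    have h3 : Real.exp (-(δ * bracket 0)) ≤ 1 := Real.exp_le_one_iff.2 (by
      have := bracket_pos 0; simp only [Left.neg_nonpos_iff]; positivity)
    have h4 := Real.exp_pos (-(δ * bracket R))
    rw [Real.arctan_zero, ← mul_sub, mul_comm]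
    gcongr
    linarith
  have hA'V : ∀ η ∈ Set.Ioc 0 R, ‖A' η‖ ≤ V η := fun η hη => by
    have hjp := bracket_pos η
    have hη0 : 0 < η := hη.1
    have hq1 : η / bracket η ≤ 1 := by
      rw [div_le_one hjp]; exact (le_abs_self η).trans (abs_le_bracket η)
    have h4 : Real.exp (-(δ * bracket η)) ≤ 1 := Real.exp_le_one_iff.2 (by
      simp only [Left.neg_nonpos_iff]; positivity)
    have hζ1 : 1 ≤ ‖ζ‖ := ht.trans (abs_le_norm_dampedTime δ t)
    simp only [hA', hV]
    rw [mul_add]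
    refine (norm_add_le _ _).trans (add_le_add ?_ ?_)
    · rw [norm_mul, Complex.norm_real, norm_mul, norm_neg, Real.norm_of_nonneg (Real.exp_pos _).le,
        Real.norm_of_nonneg (by positivity), mul_comm, mul_comm (Real.exp _)]
      gcongr
      exact hbM _ (hre η)
    · rw [norm_mul, norm_mul, norm_mul, Complex.norm_real, Complex.norm_real,
        Real.norm_of_nonneg (Real.exp_pos _).le, Real.norm_of_nonneg (by positivity)]
      have h5 := hbM' _ (hre η)
      rw [norm_mul, Complex.norm_real, Real.norm_of_nonneg hjp.le] at h5
      calc _ ≤ 1 * (M / (‖ζ‖ * bracket η) ^ 2 * (‖ζ‖ * 1)) := by gcongr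
        _ = M * (1 / (bracket η ^ 2 * ‖ζ‖)) := by field_simp
        _ ≤ M * (1 / (1 + η ^ 2)) := by
          rw [bracket_sq]
          gcongr
          exact le_mul_of_one_le_right (by positivity) hζ1
  have hI : ‖∫ η in (0 : ℝ)..R, A' η * F η‖ ≤ 3 * M * (100 / √|t|) := by
    refine (intervalIntegral.norm_integral_le_of_norm_le hR (g := fun η => V η * (100 / √|t|)) ?_
      ((hVc.mul continuous_const).intervalIntegrable _ _)).trans ?_
    · refine Filter.Eventually.of_forall fun η hη => ?_
      rw [norm_mul]
      have h1 := hA'V η hη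
      have h2 := hFb η ⟨hη.1.le, hη.2⟩
      exact mul_le_mul h1 h2 (norm_nonneg _) ((norm_nonneg _).trans h1)
    · rw [intervalIntegral.integral_mul_const]
      gcongr
  rw [e, ibp]
  have hF0 : F 0 = 0 := by simp [hF]
  rw [hF0, mul_zero, sub_zero]
  calc _ ≤ ‖A R * F R‖ + ‖∫ η in (0 : ℝ)..R, A' η * F η‖ := norm_sub_le _ _
    _ ≤ M * (100 / √|t|) + 3 * M * (100 / √|t|) := by
        rw [norm_mul]
        exact add_le_add (mul_le_mul hA_R (hFb R ⟨hR, le_rfl⟩) (norm_nonneg _) hM) hI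
    _ = _ := by ring

/-- Frequencies beyond `|t| / (16 (1 + |κ|))` are estimated absolutely, by the tail of
`∫ η^{-3/2} dη`. -/
theorem norm_integral_modelIntegrand_Ioi_le (hδ : 0 < δ) (hb : DifferentiableOn ℂ b {z | 0 < z.re})
    (hbM : ∀ z : ℂ, 0 < z.re → ‖b z‖ ≤ M) (hbM' : ∀ z : ℂ, 0 < z.re → ‖deriv b z‖ ≤ M / ‖z‖ ^ 2)
    {κ X : ℝ} (ht : 32 * (1 + |κ|) ≤ |t|) :
    ‖∫ η in Set.Ioi (0 : ℝ), modelIntegrand κ X δ t b η‖ ≤ 500 * (1 + |κ|) * M / √|t| := by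
  have hM : 0 ≤ M := (norm_nonneg _).trans (hbM 1 (by simp))
  have hκ := abs_nonneg κ
  have ht0 : 0 < |t| := by linarith
  set r := |t| / (16 * (1 + |κ|)) with hr
  have hr2 : 2 ≤ r := by rw [hr, le_div_iff₀ (by positivity)]; linarith
  -- the cutoff frequency `R` has `⟨R⟩ = |t| / (16 (1 + |κ|))`
  set R := √(r ^ 2 - 1) with hRdef
  have hRr : r / 2 ≤ R := Real.le_sqrt_of_sq_le (by nlinarith)
  have hR0 : 0 < R := by linarith
  have hbr : bracket R = r := by
    rw [bracket, hRdef, Real.sq_sqrt (by nlinarith), add_sub_cancel, Real.sqrt_sq (by linarith)]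
  have hi := integrable_modelIntegrand (t := t) hδ hb hbM κ X
  rw [← Set.Ioc_union_Ioi_eq_Ioi hR0.le, setIntegral_union (Set.Ioc_disjoint_Ioi le_rfl) measurableSet_Ioi
    hi.integrableOn hi.integrableOn, ← intervalIntegral.integral_of_le hR0.le]
  have h1 := norm_integral_modelIntegrand_zero_le (t := t) (X := X) (κ := κ) hδ (by linarith) hb hbM hbM' hR0.le (by
    rw [hbr, hr]; field_simp; rfl)
  have h2 : ‖∫ η in Set.Ioi R, modelIntegrand κ X δ t b η‖ ≤ M * (2 / √R) := by
    have e : M * (2 / √R) = ∫ η in Set.Ioi R, M * η ^ (-(3 / 2) : ℝ) := by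
      rw [integral_const_mul, integral_Ioi_rpow_of_lt (by norm_num) hR0]
      norm_num
      rw [Real.rpow_neg hR0.le, ← Real.sqrt_eq_rpow]
      ring_nf
      simp
    rw [e]
    refine norm_integral_le_of_norm_le ((integrableOn_Ioi_rpow_of_lt (by norm_num) hR0).const_mul M) ?_
    refine (ae_restrict_iff' measurableSet_Ioi).2 (Filter.Eventually.of_forall fun η hη => ?_)
    refine (norm_modelIntegrand_le hδ hbM κ X η).trans ?_
    have hη0 : 0 < η := hR0.trans hη
    refine mul_le_mul_of_nonneg_left ?_ hM
    exact Real.rpow_le_rpow_of_nonpos hη0 ((le_abs_self η).trans (abs_le_bracket η)) (by norm_num)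
  have h3 : 2 / √R ≤ 12 * (1 + |κ|) / √|t| := by
    have ht' := Real.sqrt_pos.2 ht0
    have : √|t| ≤ 6 * (1 + |κ|) * √R := by
      rw [Real.sqrt_le_left (by positivity), mul_pow, Real.sq_sqrt hR0.le]
      have : |t| = 16 * (1 + |κ|) * r := by rw [hr]; field_simp
      rw [this]
      nlinarith
    rw [div_le_div_iff₀ (Real.sqrt_pos.2 hR0) ht']
    linarith
  calc _ ≤ 400 * M / √|t| + M * (12 * (1 + |κ|) / √|t|) :=
        (norm_add_le _ _).trans (add_le_add h1 (h2.trans (by gcongr)))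
    _ = (400 + 12 * (1 + |κ|)) * M / √|t| := by ring
    _ ≤ _ := by gcongr; linarith

end model

/-- The one-dimensional estimate: decay `|t|^{-1/2}` with polynomial loss in `κ`, uniformly in the
damping, the frequency shift `X`, and factors `b` with controlled size and derivative. -/
theorem exists_norm_integral_modelIntegrand_le :
    ∃ C : ℝ, 0 ≤ C ∧ ∀ (κ X δ t M : ℝ) (b : ℂ → ℂ), 0 < δ → t ≠ 0 →
      DifferentiableOn ℂ b {z | 0 < z.re} → (∀ z : ℂ, 0 < z.re → ‖b z‖ ≤ M) →
      (∀ z : ℂ, 0 < z.re → ‖deriv b z‖ ≤ M / ‖z‖ ^ 2) →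
      ‖∫ η : ℝ, modelIntegrand κ X δ t b η‖ ≤ C * (1 + |κ|) * M / √|t| := by
  set W := ∫ η : ℝ, bracket η ^ (-(3 / 2) : ℝ) with hW
  have hW0 : 0 ≤ W := integral_nonneg fun η => Real.rpow_nonneg (bracket_pos η).le _
  refine ⟨1000 + 6 * W, by positivity, fun κ X δ t M b hδ ht hb hbM hbM' => ?_⟩
  have hM : 0 ≤ M := (norm_nonneg _).trans (hbM 1 (by simp))
  have hκ := abs_nonneg κ
  have ht0 : 0 < |t| := abs_pos.2 ht
  have ht' := Real.sqrt_pos.2 ht0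
  rcases le_total (32 * (1 + |κ|)) |t| with h | h
  · have hi := integrable_modelIntegrand (t := t) hδ hb hbM κ X
    rw [← intervalIntegral.integral_Iic_add_Ioi hi.integrableOn hi.integrableOn (b := 0)]
    have e := integral_comp_neg_Ioi (0 : ℝ) (modelIntegrand κ X δ t b)
    rw [neg_zero] at e
    rw [← e]
    simp only [modelIntegrand_neg]
    calc _ ≤ 500 * (1 + |κ|) * M / √|t| + 500 * (1 + |κ|) * M / √|t| :=
          (norm_add_le _ _).trans (add_le_add
            (norm_integral_modelIntegrand_Ioi_le hδ hb hbM hbM' h)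
            (norm_integral_modelIntegrand_Ioi_le hδ hb hbM hbM' h))
      _ = 1000 * (1 + |κ|) * M / √|t| := by ring
      _ ≤ _ := by gcongr; linarith
  -- for `|t| ≲ 1 + |κ|` the integral is bounded absolutely
  · have h1 : ‖∫ η : ℝ, modelIntegrand κ X δ t b η‖ ≤ M * W := by
      rw [hW, ← integral_const_mul]
      exact norm_integral_le_of_norm_le (integrable_bracket_rpow.const_mul M)
        (Filter.Eventually.of_forall (norm_modelIntegrand_le hδ hbM κ X))
    refine h1.trans ?_
    rw [le_div_iff₀ ht']
    have h2 : √|t| ≤ 6 * (1 + |κ|) := by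
      rw [Real.sqrt_le_left (by positivity)]
      nlinarith
    calc M * W * √|t| ≤ M * W * (6 * (1 + |κ|)) := by gcongr
      _ = 6 * W * (1 + |κ|) * M := by ring
      _ ≤ _ := by gcongr; linarith

/-! ### Laplace transforms of the radial amplitudes -/

/-- The amplitude `(2 + v)^γ (1 + v)^{a - 2iκ}` on `v ≥ 0`. -/
noncomputable def radialAmp (γ a κ v : ℝ) : ℂ :=
  (((2 + v) ^ γ : ℝ) : ℂ) * ((1 + v : ℝ) : ℂ) ^ ((a : ℂ) - 2 * Complex.I * κ)

theorem norm_radialAmp {γ a κ v : ℝ} (hv : 0 ≤ v) :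
    ‖radialAmp γ a κ v‖ = (2 + v) ^ γ * (1 + v) ^ a := by
  rw [radialAmp, norm_mul, Complex.norm_real, Real.norm_of_nonneg (by positivity),
    Complex.norm_cpow_eq_rpow_re_of_pos (by positivity)]
  simp

theorem norm_radialAmp_le {γ a κ v : ℝ} (hv : 0 ≤ v) (hγ : γ + a ≤ -(3 / 2)) :
    ‖radialAmp γ a κ v‖ ≤ 2 ^ |γ| * (1 + v) ^ (-(3 / 2) : ℝ) := by
  have h1 : 0 < 1 + v := by linarith
  have e : (2 + v : ℝ) = (2 + v) / (1 + v) * (1 + v) := by field_simp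
  have hρ : 1 ≤ (2 + v) / (1 + v) := by rw [le_div_iff₀ h1]; linarith
  have hρ2 : (2 + v) / (1 + v) ≤ 2 := by rw [div_le_iff₀ h1]; linarith
  rw [norm_radialAmp hv, e, Real.mul_rpow (by linarith) h1.le, mul_assoc, ← Real.rpow_add h1]
  have i1 : ((2 + v) / (1 + v)) ^ γ ≤ 2 ^ |γ| :=
    (Real.rpow_le_rpow_of_exponent_le hρ (le_abs_self γ)).trans
      (Real.rpow_le_rpow (by linarith) hρ2 (abs_nonneg γ))
  have i2 : (1 + v) ^ (γ + a) ≤ (1 + v) ^ (-(3 / 2) : ℝ) :=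
    Real.rpow_le_rpow_of_exponent_le (by linarith) hγ
  gcongr

theorem norm_radialAmp_le_const {γ a κ v : ℝ} (hv : 0 ≤ v) (hγ : γ + a ≤ -(3 / 2)) :
    ‖radialAmp γ a κ v‖ ≤ 2 ^ |γ| := by
  refine (norm_radialAmp_le hv hγ).trans (mul_le_of_le_one_right (by positivity) ?_)
  exact Real.rpow_le_one_of_one_le_of_nonpos (by linarith) (by norm_num)

theorem radialAmp_sub_one_left {γ a κ v : ℝ} (hv : 0 ≤ v) :
    (v : ℂ) * radialAmp (γ - 1) a κ v = radialAmp γ a κ v - 2 * radialAmp (γ - 1) a κ v := by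
  have : (((2 + v) ^ γ : ℝ) : ℂ) = (((2 + v) ^ (γ - 1) : ℝ) : ℂ) * (2 + v) := by
    rw [Real.rpow_sub_one (by positivity)]
    have : (2 + v : ℂ) ≠ 0 := by exact_mod_cast (by positivity : (2 + v : ℝ) ≠ 0)
    push_cast
    field_simp
  simp only [radialAmp, this]
  ring

theorem radialAmp_sub_one_right {γ a κ v : ℝ} (hv : 0 ≤ v) :
    (v : ℂ) * radialAmp γ (a - 1) κ v = radialAmp γ a κ v - radialAmp γ (a - 1) κ v := by
  have h1 : ((1 + v : ℝ) : ℂ) ≠ 0 := by exact_mod_cast (by positivity : (1 + v : ℝ) ≠ 0)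
  have : ((1 + v : ℝ) : ℂ) ^ ((a : ℂ) - 2 * Complex.I * κ) =
      ((1 + v : ℝ) : ℂ) ^ (((a - 1 : ℝ) : ℂ) - 2 * Complex.I * κ) * (1 + v) := by
    rw [show ((a - 1 : ℝ) : ℂ) - 2 * Complex.I * κ = ((a : ℂ) - 2 * Complex.I * κ) - 1 by push_cast; ring,
      Complex.cpow_sub ((a : ℂ) - 2 * Complex.I * κ) 1 h1, Complex.cpow_one]
    push_cast at h1 ⊢
    field_simp
  simp only [radialAmp, this]
  ring

/-- The derivative of `radialAmp`, see `hasDerivAt_radialAmp`. -/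
noncomputable def radialAmpDeriv (γ a κ v : ℝ) : ℂ :=
  γ * radialAmp (γ - 1) a κ v + ((a : ℂ) - 2 * Complex.I * κ) * radialAmp γ (a - 1) κ v

theorem hasDerivAt_radialAmp {γ a κ v : ℝ} (hv : 0 ≤ v) :
    HasDerivAt (radialAmp γ a κ) (radialAmpDeriv γ a κ v) v := by
  have h1 : HasDerivAt (fun v : ℝ => (((2 + v) ^ γ : ℝ) : ℂ)) ((γ * (2 + v) ^ (γ - 1) : ℝ) : ℂ) v := by
    have := ((hasDerivAt_id v).const_add 2).rpow_const (p := γ) (Or.inl (by simp; positivity))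
    simp only [id, one_mul] at this
    exact this.ofReal_comp
  have h2 : HasDerivAt (fun v : ℝ => ((1 + v : ℝ) : ℂ) ^ ((a : ℂ) - 2 * Complex.I * κ))
      (((a : ℂ) - 2 * Complex.I * κ) * ((1 + v : ℝ) : ℂ) ^ (((a : ℂ) - 2 * Complex.I * κ) - 1) * 1) v := by
    have h := ((hasDerivAt_id v).const_add 1).ofReal_comp
    have hs : ((1 + v : ℝ) : ℂ) ∈ Complex.slitPlane := by left; simp; positivity
    have h' := ((hasDerivAt_id ((1 + v : ℝ) : ℂ)).cpow_const (c := (a : ℂ) - 2 * Complex.I * κ) hs).comp v h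
    refine h'.congr_deriv ?_
    simp
  refine (h1.mul h2).congr_deriv ?_
  simp only [radialAmpDeriv, radialAmp]
  rw [show ((a - 1 : ℝ) : ℂ) - 2 * Complex.I * κ = ((a : ℂ) - 2 * Complex.I * κ) - 1 by push_cast; ring]
  push_cast
  ring

theorem continuousOn_radialAmp (γ a κ : ℝ) : ContinuousOn (radialAmp γ a κ) (Set.Ici 0) := fun _ hv =>
  (hasDerivAt_radialAmp hv).continuousAt.continuousWithinAt

theorem norm_exponent_le (a κ : ℝ) : ‖(a : ℂ) - 2 * Complex.I * κ‖ ≤ (|a| + 2) * (1 + |κ|) := by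
  refine (norm_sub_le _ _).trans ?_
  simp only [norm_mul, Complex.norm_real, Complex.norm_I, Real.norm_eq_abs, Complex.norm_ofNat]
  nlinarith [abs_nonneg a, abs_nonneg κ, mul_nonneg (abs_nonneg a) (abs_nonneg κ)]

theorem exists_norm_radialAmpDeriv_le {γ a : ℝ} (hγ : γ + a ≤ -(3 / 2)) :
    ∃ D : ℝ, 0 ≤ D ∧ ∀ κ v : ℝ, 0 ≤ v →
      ‖radialAmpDeriv γ a κ v‖ ≤ D * (1 + |κ|) * (1 + v) ^ (-(3 / 2) : ℝ) := by
  refine ⟨|γ| * 2 ^ |γ - 1| + (|a| + 2) * 2 ^ |γ|, by positivity, fun κ v hv => ?_⟩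
  have h1 := norm_radialAmp_le (γ := γ - 1) (a := a) (κ := κ) hv (by linarith)
  have h2 := norm_radialAmp_le (γ := γ) (a := a - 1) (κ := κ) hv (by linarith)
  have h3 := norm_exponent_le a κ
  have hκ := abs_nonneg κ
  calc ‖radialAmpDeriv γ a κ v‖ ≤ |γ| * (2 ^ |γ - 1| * (1 + v) ^ (-(3 / 2) : ℝ)) +
        (|a| + 2) * (1 + |κ|) * (2 ^ |γ| * (1 + v) ^ (-(3 / 2) : ℝ)) := by
        refine (norm_add_le _ _).trans (add_le_add ?_ ?_)
        · rw [norm_mul, Complex.norm_real, Real.norm_eq_abs]; gcongr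
        · rw [norm_mul]; gcongr
    _ = (|γ| * 2 ^ |γ - 1| * 1 + (|a| + 2) * (1 + |κ|) * 2 ^ |γ|) * (1 + v) ^ (-(3 / 2) : ℝ) := by ring
    _ ≤ (|γ| * 2 ^ |γ - 1| * (1 + |κ|) + (|a| + 2) * (1 + |κ|) * 2 ^ |γ|) * (1 + v) ^ (-(3 / 2) : ℝ) := by
        gcongr; linarith
    _ = _ := by ring

/-- The Laplace transform `∫₀^∞ e^{-zv} v^{β-1} (2 + v)^γ (1 + v)^{a - 2iκ} dv`. -/
noncomputable def radialLaplace (β γ a κ : ℝ) (z : ℂ) : ℂ :=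
  ∫ v in Set.Ioi (0 : ℝ), Complex.exp (-z * v) * ((v ^ (β - 1) : ℝ) : ℂ) * radialAmp γ a κ v

theorem norm_exp_neg_mul_ofReal (z : ℂ) (v : ℝ) : ‖Complex.exp (-z * v)‖ = Real.exp (-z.re * v) := by
  rw [Complex.norm_exp, Complex.re_mul_ofReal, Complex.neg_re]

theorem norm_exp_neg_mul_ofReal_le_one {z : ℂ} (hz : 0 < z.re) {v : ℝ} (hv : 0 ≤ v) :
    ‖Complex.exp (-z * v)‖ ≤ 1 := by
  rw [norm_exp_neg_mul_ofReal]
  exact Real.exp_le_one_iff.2 (by nlinarith)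

theorem aestronglyMeasurable_laplace {c : ℝ → ℂ} (hc : ContinuousOn c (Set.Ici 0)) (β : ℝ) (z : ℂ) :
    AEStronglyMeasurable (fun v : ℝ => Complex.exp (-z * v) * ((v ^ (β - 1) : ℝ) : ℂ) * c v)
      (volume.restrict (Set.Ioi 0)) := by
  refine ContinuousOn.aestronglyMeasurable ?_ measurableSet_Ioi
  refine ContinuousOn.mul (ContinuousOn.mul (by fun_prop) ?_) (hc.mono Set.Ioi_subset_Ici_self)
  exact Complex.continuous_ofReal.comp_continuousOn
    (continuousOn_id.rpow_const fun v hv => Or.inl (ne_of_gt hv))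

theorem integrableOn_rpow_mul_exp {β r : ℝ} (hβ : 0 < β) (hr : 0 < r) :
    IntegrableOn (fun v : ℝ => Real.exp (-r * v) * v ^ (β - 1)) (Set.Ioi 0) := by
  have := integrableOn_rpow_mul_exp_neg_mul_rpow (s := β - 1) (p := 1) (b := r) (by linarith) one_pos hr
  refine this.congr_fun (fun v _ => ?_) measurableSet_Ioi
  simp only [Real.rpow_one, mul_comm]

theorem integrableOn_laplace {c : ℝ → ℂ} (hc : ContinuousOn c (Set.Ici 0)) {A β : ℝ} {z : ℂ}
    (hA : ∀ v : ℝ, 0 ≤ v → ‖c v‖ ≤ A) (hβ : 0 < β) (hz : 0 < z.re) :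
    IntegrableOn (fun v : ℝ => Complex.exp (-z * v) * ((v ^ (β - 1) : ℝ) : ℂ) * c v) (Set.Ioi 0) := by
  refine ((integrableOn_rpow_mul_exp hβ hz).mul_const A).mono' (aestronglyMeasurable_laplace hc β z) ?_
  refine (ae_restrict_iff' measurableSet_Ioi).2 (Filter.Eventually.of_forall fun v hv => ?_)
  have hv0 : 0 < v := hv
  rw [norm_mul, norm_mul, norm_exp_neg_mul_ofReal, Complex.norm_real, Real.norm_of_nonneg (by positivity)]
  gcongr
  exact hA v hv0.le

theorem integrableOn_radialLaplace {β γ a κ : ℝ} {z : ℂ} (hγ : γ + a ≤ -(3 / 2)) (hβ : 0 < β) (hz : 0 < z.re) :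
    IntegrableOn (fun v : ℝ => Complex.exp (-z * v) * ((v ^ (β - 1) : ℝ) : ℂ) * radialAmp γ a κ v)
      (Set.Ioi 0) :=
  integrableOn_laplace (continuousOn_radialAmp γ a κ) (fun _ hv => norm_radialAmp_le_const hv hγ) hβ hz

theorem continuousOn_radialAmpDeriv (γ a κ : ℝ) : ContinuousOn (radialAmpDeriv γ a κ) (Set.Ici 0) :=
  (continuousOn_const.mul (continuousOn_radialAmp _ _ _)).add
    (continuousOn_const.mul (continuousOn_radialAmp _ _ _))

theorem integrableOn_radialLaplace_deriv {β γ a κ : ℝ} {z : ℂ} (hγ : γ + a ≤ -(3 / 2)) (hβ : 0 < β)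
    (hz : 0 < z.re) :
    IntegrableOn (fun v : ℝ => Complex.exp (-z * v) * ((v ^ (β - 1) : ℝ) : ℂ) * radialAmpDeriv γ a κ v)
      (Set.Ioi 0) := by
  obtain ⟨D, hD, h⟩ := exists_norm_radialAmpDeriv_le hγ
  refine integrableOn_laplace (continuousOn_radialAmpDeriv γ a κ) (A := D * (1 + |κ|)) (fun v hv => ?_) hβ hz
  refine (h κ v hv).trans (mul_le_of_le_one_right (by positivity) ?_)
  exact Real.rpow_le_one_of_one_le_of_nonpos (by linarith) (by norm_num)

theorem integral_laplace_radialAmpDeriv {β γ a κ : ℝ} {z : ℂ} (hγ : γ + a ≤ -(3 / 2)) (hβ : 0 < β)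
    (hz : 0 < z.re) :
    ∫ v in Set.Ioi (0 : ℝ), Complex.exp (-z * v) * ((v ^ (β - 1) : ℝ) : ℂ) * radialAmpDeriv γ a κ v =
      γ * radialLaplace β (γ - 1) a κ z + ((a : ℂ) - 2 * Complex.I * κ) * radialLaplace β γ (a - 1) κ z := by
  rw [radialLaplace, radialLaplace, ← integral_const_mul, ← integral_const_mul, ← integral_add]
  · refine setIntegral_congr_fun measurableSet_Ioi fun v _ => ?_
    simp only [radialAmpDeriv]; ring
  · exact (integrableOn_radialLaplace (by linarith) hβ hz).const_mul _
  · exact (integrableOn_radialLaplace (by linarith) hβ hz).const_mul _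

theorem hasDerivAt_exp_rpow_radialAmp {s γ a κ v : ℝ} (z : ℂ) (hv : 0 < v) :
    HasDerivAt (fun v : ℝ => Complex.exp (-z * v) * ((v ^ s : ℝ) : ℂ) * radialAmp γ a κ v)
      (-z * (Complex.exp (-z * v) * ((v ^ s : ℝ) : ℂ) * radialAmp γ a κ v) +
        s * (Complex.exp (-z * v) * ((v ^ (s - 1) : ℝ) : ℂ) * radialAmp γ a κ v) +
        Complex.exp (-z * v) * ((v ^ s : ℝ) : ℂ) * radialAmpDeriv γ a κ v) v := by
  have h1 : HasDerivAt (fun v : ℝ => Complex.exp (-z * v)) (Complex.exp (-z * v) * (-z * 1)) v :=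
    ((Complex.ofRealCLM.hasDerivAt (x := v)).const_mul (-z)).cexp
  have h2 := (Real.hasDerivAt_rpow_const (p := s) (Or.inl hv.ne')).ofReal_comp
  refine ((h1.mul h2).mul (hasDerivAt_radialAmp hv.le)).congr_deriv ?_
  simp only [Pi.mul_apply]
  push_cast
  ring

theorem integral_const_mul_add_const_mul_add {μ : Measure ℝ} {f g h : ℝ → ℂ} {c d : ℂ}
    (hf : Integrable f μ) (hg : Integrable g μ) (hh : Integrable h μ) :
    ∫ x, (c * f x + d * g x + h x) ∂μ = c * ∫ x, f x ∂μ + d * ∫ x, g x ∂μ + ∫ x, h x ∂μ := by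
  have h1 : Integrable (fun x => c * f x + d * g x) μ := (hf.const_mul c).add (hg.const_mul d)
  rw [integral_add h1 hh, integral_add (hf.const_mul c) (hg.const_mul d), integral_const_mul,
    integral_const_mul]

/-- Integration by parts in the Laplace transform. -/
theorem mul_radialLaplace_add_one {β γ a κ : ℝ} {z : ℂ} (hγ : γ + a ≤ -(3 / 2)) (hβ : 0 < β) (hz : 0 < z.re) :
    z * radialLaplace (β + 1) γ a κ z = β * radialLaplace β γ a κ z +
      (γ * radialLaplace (β + 1) (γ - 1) a κ z +
        ((a : ℂ) - 2 * Complex.I * κ) * radialLaplace (β + 1) γ (a - 1) κ z) := by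
  have i0 := integrableOn_radialLaplace (κ := κ) (β := β + 1) hγ (by linarith) hz
  have i1 := integrableOn_radialLaplace (κ := κ) (β := β) hγ hβ hz
  have i2 := integrableOn_radialLaplace_deriv (κ := κ) (β := β + 1) hγ (by linarith) hz
  rw [← integral_laplace_radialAmpDeriv hγ (by linarith) hz]
  simp only [radialLaplace, add_sub_cancel_right] at i0 i2 ⊢
  have hd := fun v (hv : v ∈ Set.Ioi (0 : ℝ)) =>
    hasDerivAt_exp_rpow_radialAmp (s := β) (γ := γ) (a := a) (κ := κ) z hv
  have j := ((i0.const_mul (-z)).add (i1.const_mul β)).add i2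
  have key := integral_Ioi_of_hasDerivAt_of_tendsto (a := (0 : ℝ)) (m := (0 : ℂ)) ?_ hd j
    (tendsto_zero_of_hasDerivAt_of_integrableOn_Ioi hd j i0)
  · rw [integral_const_mul_add_const_mul_add i0 i1 i2, Real.zero_rpow hβ.ne'] at key
    simp only [Complex.ofReal_zero, mul_zero, zero_mul, sub_zero] at key
    linear_combination -key
  · refine ContinuousWithinAt.mul (ContinuousWithinAt.mul (by fun_prop) ?_)
      (continuousOn_radialAmp γ a κ 0 Set.self_mem_Ici)
    exact (Complex.continuous_ofReal.comp (Real.continuous_rpow_const hβ.le)).continuousWithinAt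

/-- Uniform decay `|z|^{-β}` of all the Laplace transforms of index `β`, with polynomial loss in `κ`. -/
def RadialLaplaceBound (β : ℝ) : Prop :=
  ∀ γ a : ℝ, γ + a ≤ -(3 / 2) → ∃ C : ℝ, 0 ≤ C ∧ ∃ N : ℕ, ∀ (κ : ℝ) (z : ℂ), 0 < z.re →
    ‖radialLaplace β γ a κ z‖ ≤ C * (1 + |κ|) ^ N * ‖z‖ ^ (-β)

theorem norm_pos_of_re_pos {z : ℂ} (hz : 0 < z.re) : 0 < ‖z‖ := hz.trans_le (Complex.re_le_norm z)

/-- One integration by parts suffices, since the derivative of the amplitude is integrable. -/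
theorem radialLaplaceBound_one : RadialLaplaceBound 1 := by
  intro γ a hγ
  obtain ⟨D, hD, hDb⟩ := exists_norm_radialAmpDeriv_le hγ
  have hWi : IntegrableOn (fun v : ℝ => (1 + v) ^ (-(3 / 2) : ℝ)) (Set.Ioi 0) := by
    refine integrable_bracket_rpow.integrableOn.mono' ?_ ?_
    · refine ContinuousOn.aestronglyMeasurable ?_ measurableSet_Ioi
      exact (continuousOn_const.add continuousOn_id).rpow_const fun v hv =>
        Or.inl (by have : (0 : ℝ) < v := hv; exact (by positivity : (1 : ℝ) + v ≠ 0))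
    · refine (ae_restrict_iff' measurableSet_Ioi).2 (Filter.Eventually.of_forall fun v hv => ?_)
      have hv0 : (0 : ℝ) < v := hv
      rw [Real.norm_of_nonneg (by positivity)]
      exact Real.rpow_le_rpow_of_nonpos (bracket_pos v)
        (Real.sqrt_le_iff.2 ⟨by positivity, by nlinarith⟩) (by norm_num)
  set W := ∫ v in Set.Ioi (0 : ℝ), (1 + v) ^ (-(3 / 2) : ℝ) with hW
  have hW0 : 0 ≤ W := setIntegral_nonneg measurableSet_Ioi fun v hv => by
    have : (0 : ℝ) < v := hv
    positivity
  refine ⟨2 ^ |γ| + D * W, by positivity, 1, fun κ z hz => ?_⟩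
  have hzp := norm_pos_of_re_pos hz
  have i0 := integrableOn_radialLaplace (κ := κ) (β := 1) hγ one_pos hz
  have i2 := integrableOn_radialLaplace_deriv (κ := κ) (β := 1) hγ one_pos hz
  have hd := fun v (hv : v ∈ Set.Ioi (0 : ℝ)) =>
    hasDerivAt_exp_rpow_radialAmp (s := 0) (γ := γ) (a := a) (κ := κ) z hv
  simp only [radialLaplace, sub_self, Complex.ofReal_zero, zero_mul, add_zero] at i0 i2 hd ⊢
  have j := (i0.const_mul (-z)).add i2
  have key := integral_Ioi_of_hasDerivAt_of_tendsto (a := (0 : ℝ)) (m := (0 : ℂ)) ?_ hd j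
    (tendsto_zero_of_hasDerivAt_of_integrableOn_Ioi hd j i0)
  swap
  · refine ContinuousWithinAt.mul (ContinuousWithinAt.mul (by fun_prop) ?_)
      (continuousOn_radialAmp γ a κ 0 Set.self_mem_Ici)
    simp only [Real.rpow_zero]
    exact continuousWithinAt_const
  rw [integral_add (i0.const_mul (-z)) i2, integral_const_mul] at key
  simp only [Complex.ofReal_zero, mul_zero, Complex.exp_zero, Real.rpow_zero, Complex.ofReal_one, one_mul,
    zero_sub] at key
  set J := ∫ v in Set.Ioi (0 : ℝ), Complex.exp (-z * v) * ((v ^ (0 : ℝ) : ℝ) : ℂ) * radialAmpDeriv γ a κ v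
  have hJ : ‖J‖ ≤ D * (1 + |κ|) * W := by
    rw [hW, ← integral_const_mul]
    refine norm_integral_le_of_norm_le (hWi.const_mul _) ?_
    refine (ae_restrict_iff' measurableSet_Ioi).2 (Filter.Eventually.of_forall fun v hv => ?_)
    have hv0 : (0 : ℝ) < v := hv
    rw [Real.rpow_zero, Complex.ofReal_one, mul_one, norm_mul]
    calc _ ≤ 1 * _ := mul_le_mul (norm_exp_neg_mul_ofReal_le_one hz hv0.le) (hDb κ v hv0.le)
          (norm_nonneg _) zero_le_one
      _ = _ := one_mul _
  simp only [Real.rpow_zero, Complex.ofReal_one, mul_one] at key ⊢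
  set I0 := ∫ v in Set.Ioi (0 : ℝ), Complex.exp (-z * v) * radialAmp γ a κ v
  have hz' : z * I0 = radialAmp γ a κ 0 + J := by
    have hJe : J = ∫ v in Set.Ioi (0 : ℝ), Complex.exp (-z * v) * radialAmpDeriv γ a κ v := by
      simp only [J, Real.rpow_zero, Complex.ofReal_one, mul_one]
    rw [hJe]
    linear_combination -key
  have hn : ‖z‖ * ‖I0‖ ≤ 2 ^ |γ| + D * (1 + |κ|) * W := by
    rw [← norm_mul, hz']
    exact (norm_add_le _ _).trans (add_le_add (norm_radialAmp_le_const le_rfl hγ) hJ)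
  rw [Real.rpow_neg_one, pow_one, ← div_eq_mul_inv, le_div_iff₀ hzp, mul_comm]
  refine hn.trans ?_
  have : (0 : ℝ) ≤ 2 ^ |γ| * |κ| := by positivity
  nlinarith

/-- The integral is estimated absolutely below the scale `1/|z|` and by one integration by parts
above it. -/
theorem radialLaplaceBound_half : RadialLaplaceBound (1 / 2) := by
  intro γ a hγ
  obtain ⟨D, hD, hDb⟩ := exists_norm_radialAmpDeriv_le hγ
  set A : ℝ := 2 ^ |γ| with hA
  have hA0 : 0 < A := by positivity
  refine ⟨4 * A + 2 * D, by positivity, 1, fun κ z hz => ?_⟩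
  have hzp := norm_pos_of_re_pos hz
  have hAb := fun (v : ℝ) (hv : 0 ≤ v) => norm_radialAmp_le_const (κ := κ) hv hγ
  have i0 := integrableOn_radialLaplace (κ := κ) (β := 1 / 2) hγ (by norm_num) hz
  have i2 := integrableOn_radialLaplace_deriv (κ := κ) (β := 1 / 2) hγ (by norm_num) hz
  -- below the scale `r = 1/|z|` the exponential does not oscillate
  set r : ℝ := ‖z‖⁻¹ with hr
  have hr0 : 0 < r := inv_pos.2 hzp
  have hrs : r ^ (1 / 2 : ℝ) = ‖z‖ ^ (-(1 / 2) : ℝ) := by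
    rw [hr, Real.inv_rpow hzp.le, Real.rpow_neg hzp.le]
  have hsub : Set.Ioi r ⊆ Set.Ioi (0 : ℝ) := Set.Ioi_subset_Ioi hr0.le
  have hsub' : Set.Ioc 0 r ⊆ Set.Ioi (0 : ℝ) := fun v hv => hv.1
  have hsmall : ‖∫ v in Set.Ioc 0 r, Complex.exp (-z * v) * ((v ^ (1 / 2 - 1 : ℝ) : ℝ) : ℂ) *
      radialAmp γ a κ v‖ ≤ 2 * A * r ^ (1 / 2 : ℝ) := by
    have hi : IntervalIntegrable (fun v : ℝ => v ^ (1 / 2 - 1 : ℝ) * A) volume 0 r :=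
      (intervalIntegral.intervalIntegrable_rpow' (by norm_num)).mul_const _
    have e : ∫ v in Set.Ioc 0 r, v ^ (1 / 2 - 1 : ℝ) * A = 2 * A * r ^ (1 / 2 : ℝ) := by
      rw [← intervalIntegral.integral_of_le hr0.le, intervalIntegral.integral_mul_const,
        integral_rpow (Or.inl (by norm_num)), sub_add_cancel, Real.zero_rpow (by norm_num)]
      ring
    rw [← e]
    refine norm_integral_le_of_norm_le ((intervalIntegrable_iff_integrableOn_Ioc_of_le hr0.le).1 hi) ?_
    refine (ae_restrict_iff' measurableSet_Ioc).2 (Filter.Eventually.of_forall fun v hv => ?_)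
    have hv0 : 0 < v := hv.1
    rw [norm_mul, norm_mul, Complex.norm_real, Real.norm_of_nonneg (by positivity)]
    have h1 := norm_exp_neg_mul_ofReal_le_one hz hv0.le
    have h2 := hAb v hv0.le
    calc _ ≤ 1 * v ^ (1 / 2 - 1 : ℝ) * A := by gcongr
      _ = _ := by rw [one_mul]
  have hlarge : ‖∫ v in Set.Ioi r, Complex.exp (-z * v) * ((v ^ (1 / 2 - 1 : ℝ) : ℝ) : ℂ) *
      radialAmp γ a κ v‖ ≤ (2 * A + 2 * (D * (1 + |κ|))) * r ^ (1 / 2 : ℝ) := by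
    have hd := fun v (hv : v ∈ Set.Ici r) =>
      hasDerivAt_exp_rpow_radialAmp (s := 1 / 2 - 1) (γ := γ) (a := a) (κ := κ) z (hr0.trans_le hv)
    have hpi : IntegrableOn (fun v : ℝ => v ^ (-(3 / 2) : ℝ)) (Set.Ioi r) :=
      integrableOn_Ioi_rpow_of_lt (by norm_num) hr0
    have i1 : IntegrableOn (fun v : ℝ => Complex.exp (-z * v) * ((v ^ (1 / 2 - 1 - 1 : ℝ) : ℝ) : ℂ) *
        radialAmp γ a κ v) (Set.Ioi r) := by
      refine (hpi.mul_const A).mono' ?_ ?_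
      · have := (aestronglyMeasurable_laplace (continuousOn_radialAmp γ a κ) (1 / 2 - 1) z)
        exact this.mono_measure (Measure.restrict_mono hsub le_rfl)
      · refine (ae_restrict_iff' measurableSet_Ioi).2 (Filter.Eventually.of_forall fun v hv => ?_)
        have hv0 : 0 < v := hr0.trans hv
        rw [norm_mul, norm_mul, Complex.norm_real, Real.norm_of_nonneg (by positivity)]
        have h1 := norm_exp_neg_mul_ofReal_le_one hz hv0.le
        have h2 := hAb v hv0.le
        calc _ ≤ 1 * v ^ (1 / 2 - 1 - 1 : ℝ) * A := by gcongr
          _ = _ := by rw [one_mul]; norm_num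
    have i0' := i0.mono_set hsub
    have i2' := i2.mono_set hsub
    have j := ((i0'.const_mul (-z)).add (i1.const_mul ((1 / 2 - 1 : ℝ) : ℂ))).add i2'
    have hd' := fun v (hv : v ∈ Set.Ioi r) => hd v (Set.mem_Ici.2 (le_of_lt hv))
    have key := integral_Ioi_of_hasDerivAt_of_tendsto' (m := (0 : ℂ)) hd j
      (tendsto_zero_of_hasDerivAt_of_integrableOn_Ioi hd' j i0')
    rw [integral_const_mul_add_const_mul_add i0' i1 i2'] at key
    have hWr : ∫ v in Set.Ioi r, v ^ (-(3 / 2) : ℝ) = 2 * r ^ (-(1 / 2) : ℝ) := by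
      rw [integral_Ioi_rpow_of_lt (by norm_num) hr0]
      norm_num
      ring
    have e1 : ‖∫ v in Set.Ioi r, Complex.exp (-z * v) * ((v ^ (1 / 2 - 1 - 1 : ℝ) : ℝ) : ℂ) *
        radialAmp γ a κ v‖ ≤ 2 * A * r ^ (-(1 / 2) : ℝ) := by
      have : ∫ v in Set.Ioi r, v ^ (-(3 / 2) : ℝ) * A = 2 * A * r ^ (-(1 / 2) : ℝ) := by
        rw [integral_mul_const, hWr]; ring
      rw [← this]
      refine norm_integral_le_of_norm_le (hpi.mul_const A) ?_
      refine (ae_restrict_iff' measurableSet_Ioi).2 (Filter.Eventually.of_forall fun v hv => ?_)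
      have hv0 : 0 < v := hr0.trans hv
      rw [norm_mul, norm_mul, Complex.norm_real, Real.norm_of_nonneg (by positivity)]
      have h1 := norm_exp_neg_mul_ofReal_le_one hz hv0.le
      have h2 := hAb v hv0.le
      calc _ ≤ 1 * v ^ (1 / 2 - 1 - 1 : ℝ) * A := by gcongr
        _ = _ := by rw [one_mul]; norm_num
    have e2 : ‖∫ v in Set.Ioi r, Complex.exp (-z * v) * ((v ^ (1 / 2 - 1 : ℝ) : ℝ) : ℂ) *
        radialAmpDeriv γ a κ v‖ ≤ 2 * (D * (1 + |κ|)) * r ^ (-(1 / 2) : ℝ) := by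
      have : ∫ v in Set.Ioi r, v ^ (-(3 / 2) : ℝ) * (D * (1 + |κ|)) = 2 * (D * (1 + |κ|)) * r ^ (-(1 / 2) : ℝ) := by
        rw [integral_mul_const, hWr]; ring
      rw [← this]
      refine norm_integral_le_of_norm_le (hpi.mul_const _) ?_
      refine (ae_restrict_iff' measurableSet_Ioi).2 (Filter.Eventually.of_forall fun v hv => ?_)
      have hv0 : 0 < v := hr0.trans hv
      rw [norm_mul, norm_mul, Complex.norm_real, Real.norm_of_nonneg (by positivity)]
      have h1 := norm_exp_neg_mul_ofReal_le_one hz hv0.le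
      have h2 := hDb κ v hv0.le
      have h3 : (1 + v) ^ (-(3 / 2) : ℝ) ≤ v ^ (-1 : ℝ) :=
        (Real.rpow_le_rpow_of_exponent_le (by linarith) (by norm_num : (-(3 / 2) : ℝ) ≤ -1)).trans
          (Real.rpow_le_rpow_of_nonpos hv0 (by linarith) (by norm_num))
      calc _ ≤ 1 * v ^ (1 / 2 - 1 : ℝ) * (D * (1 + |κ|) * v ^ (-1 : ℝ)) := by
            gcongr
            exact h2.trans (by gcongr)
        _ = (v ^ (1 / 2 - 1 : ℝ) * v ^ (-1 : ℝ)) * (D * (1 + |κ|)) := by ring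
        _ = _ := by rw [← Real.rpow_add hv0]; norm_num
    have e3 : ‖Complex.exp (-z * r) * ((r ^ (1 / 2 - 1 : ℝ) : ℝ) : ℂ) * radialAmp γ a κ r‖ ≤
        A * r ^ (-(1 / 2) : ℝ) := by
      rw [norm_mul, norm_mul, Complex.norm_real, Real.norm_of_nonneg (by positivity)]
      have h1 := norm_exp_neg_mul_ofReal_le_one hz hr0.le
      have h2 := hAb r hr0.le
      calc _ ≤ 1 * r ^ (1 / 2 - 1 : ℝ) * A := by gcongr
        _ = _ := by rw [one_mul, mul_comm]; norm_num
    set I0 := ∫ v in Set.Ioi r, Complex.exp (-z * v) * ((v ^ (1 / 2 - 1 : ℝ) : ℝ) : ℂ) * radialAmp γ a κ v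
    set I1 := ∫ v in Set.Ioi r, Complex.exp (-z * v) * ((v ^ (1 / 2 - 1 - 1 : ℝ) : ℝ) : ℂ) * radialAmp γ a κ v
    set I2 := ∫ v in Set.Ioi r, Complex.exp (-z * v) * ((v ^ (1 / 2 - 1 : ℝ) : ℝ) : ℂ) * radialAmpDeriv γ a κ v
    have hz' : z * I0 = Complex.exp (-z * r) * ((r ^ (1 / 2 - 1 : ℝ) : ℝ) : ℂ) * radialAmp γ a κ r +
        ((1 / 2 - 1 : ℝ) : ℂ) * I1 + I2 := by linear_combination -key
    have hn : ‖z‖ * ‖I0‖ ≤ (2 * A + 2 * (D * (1 + |κ|))) * r ^ (-(1 / 2) : ℝ) := by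
      rw [← norm_mul, hz']
      calc _ ≤ A * r ^ (-(1 / 2) : ℝ) + 1 / 2 * (2 * A * r ^ (-(1 / 2) : ℝ)) +
            2 * (D * (1 + |κ|)) * r ^ (-(1 / 2) : ℝ) := by
            refine (norm_add_le _ _).trans (add_le_add ((norm_add_le _ _).trans (add_le_add e3 ?_)) e2)
            rw [norm_mul, Complex.norm_real]
            have : ‖(1 / 2 - 1 : ℝ)‖ = 1 / 2 := by norm_num
            rw [this]
            gcongr
        _ = _ := by ring
    have hrr : r ^ (1 / 2 : ℝ) = r ^ (-(1 / 2) : ℝ) * r := by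
      rw [← Real.rpow_add_one hr0.ne']; norm_num
    rw [hrr, ← mul_assoc, hr, ← div_eq_mul_inv, le_div_iff₀ hzp, mul_comm ‖I0‖, ← hr]
    exact hn
  have hu : radialLaplace (1 / 2) γ a κ z =
      (∫ v in Set.Ioc 0 r, Complex.exp (-z * v) * ((v ^ (1 / 2 - 1 : ℝ) : ℝ) : ℂ) * radialAmp γ a κ v) +
      ∫ v in Set.Ioi r, Complex.exp (-z * v) * ((v ^ (1 / 2 - 1 : ℝ) : ℝ) : ℂ) * radialAmp γ a κ v := by
    rw [radialLaplace, ← Set.Ioc_union_Ioi_eq_Ioi hr0.le, setIntegral_union (Set.Ioc_disjoint_Ioi le_rfl)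
      measurableSet_Ioi (i0.mono_set hsub') (i0.mono_set hsub)]
  rw [hu, ← hrs, pow_one]
  refine (norm_add_le _ _).trans ((add_le_add hsmall hlarge).trans ?_)
  rw [← add_mul]
  refine mul_le_mul_of_nonneg_right ?_ (by positivity)
  nlinarith [abs_nonneg κ, mul_nonneg hA0.le (abs_nonneg κ)]

theorem radialLaplace_add_one_sub_left {β γ a κ : ℝ} {z : ℂ} (hγ : γ + a ≤ -(3 / 2)) (hβ : 0 < β)
    (hz : 0 < z.re) : radialLaplace (β + 1) (γ - 1) a κ z =
      radialLaplace β γ a κ z - 2 * radialLaplace β (γ - 1) a κ z := by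
  have i1 := integrableOn_radialLaplace (κ := κ) hγ hβ hz
  have i2 := integrableOn_radialLaplace (κ := κ) (γ := γ - 1) (a := a) (by linarith) hβ hz
  simp only [radialLaplace]
  rw [← integral_const_mul, ← integral_sub i1 (i2.const_mul 2)]
  refine setIntegral_congr_fun measurableSet_Ioi fun v hv => ?_
  have hv0 : (0 : ℝ) < v := hv
  have h := radialAmp_sub_one_left (γ := γ) (a := a) (κ := κ) hv0.le
  have hp : ((v ^ (β + 1 - 1) : ℝ) : ℂ) = ((v ^ (β - 1) : ℝ) : ℂ) * v := by
    rw [← Complex.ofReal_mul, ← Real.rpow_add_one hv0.ne']; congr 2; ring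
  simp only [hp]
  linear_combination (Complex.exp (-z * v) * ((v ^ (β - 1) : ℝ) : ℂ)) * h

theorem radialLaplace_add_one_sub_right {β γ a κ : ℝ} {z : ℂ} (hγ : γ + a ≤ -(3 / 2)) (hβ : 0 < β)
    (hz : 0 < z.re) : radialLaplace (β + 1) γ (a - 1) κ z =
      radialLaplace β γ a κ z - radialLaplace β γ (a - 1) κ z := by
  have i1 := integrableOn_radialLaplace (κ := κ) hγ hβ hz
  have i2 := integrableOn_radialLaplace (κ := κ) (γ := γ) (a := a - 1) (by linarith) hβ hz
  simp only [radialLaplace]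
  rw [← integral_sub i1 i2]
  refine setIntegral_congr_fun measurableSet_Ioi fun v hv => ?_
  have hv0 : (0 : ℝ) < v := hv
  have h := radialAmp_sub_one_right (γ := γ) (a := a) (κ := κ) hv0.le
  have hp : ((v ^ (β + 1 - 1) : ℝ) : ℂ) = ((v ^ (β - 1) : ℝ) : ℂ) * v := by
    rw [← Complex.ofReal_mul, ← Real.rpow_add_one hv0.ne']; congr 2; ring
  simp only [hp]
  linear_combination (Complex.exp (-z * v) * ((v ^ (β - 1) : ℝ) : ℂ)) * h

/-- Integration by parts, followed by `v = (2 + v) - 2` and `v = (1 + v) - 1`, expresses `z` times a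
Laplace transform of index `β + 1` by transforms of index `β`. -/
theorem RadialLaplaceBound.add_one {β : ℝ} (hβ : 0 < β) (h : RadialLaplaceBound β) :
    RadialLaplaceBound (β + 1) := by
  intro γ a hγ
  obtain ⟨C1, hC1, N1, h1⟩ := h γ a hγ
  obtain ⟨C2, hC2, N2, h2⟩ := h (γ - 1) a (by linarith)
  obtain ⟨C3, hC3, N3, h3⟩ := h γ (a - 1) (by linarith)
  refine ⟨β * C1 + |γ| * (C1 + 2 * C2) + (|a| + 2) * (C1 + C3), by positivity, N1 + N2 + N3 + 1,
    fun κ z hz => ?_⟩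
  have hzp := norm_pos_of_re_pos hz
  have hκ : 1 ≤ 1 + |κ| := by have := abs_nonneg κ; linarith
  set K := (1 + |κ|) ^ (N1 + N2 + N3) with hK
  have p1 : (1 + |κ|) ^ N1 ≤ K := pow_le_pow_right₀ hκ (by omega)
  have p2 : (1 + |κ|) ^ N2 ≤ K := pow_le_pow_right₀ hκ (by omega)
  have p3 : (1 + |κ|) ^ N3 ≤ K := pow_le_pow_right₀ hκ (by omega)
  have hK0 : 0 ≤ K := by positivity
  set Z := ‖z‖ ^ (-β) with hZ
  have hZ0 : 0 ≤ Z := by positivity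
  have b1 : ‖radialLaplace β γ a κ z‖ ≤ C1 * K * Z := (h1 κ z hz).trans (by gcongr)
  have b2 : ‖radialLaplace β (γ - 1) a κ z‖ ≤ C2 * K * Z := (h2 κ z hz).trans (by gcongr)
  have b3 : ‖radialLaplace β γ (a - 1) κ z‖ ≤ C3 * K * Z := (h3 κ z hz).trans (by gcongr)
  have key := mul_radialLaplace_add_one (κ := κ) hγ hβ hz
  rw [radialLaplace_add_one_sub_left hγ hβ hz, radialLaplace_add_one_sub_right hγ hβ hz] at key
  have e : ‖z‖ ^ (-(β + 1)) = Z / ‖z‖ := by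
    rw [hZ, neg_add, ← sub_eq_add_neg, Real.rpow_sub_one hzp.ne']
  rw [e, mul_div_assoc', le_div_iff₀ hzp, mul_comm ‖_‖, ← norm_mul, key]
  calc _ ≤ β * (C1 * K * Z) + (|γ| * (C1 * K * Z + 2 * (C2 * K * Z)) +
        (|a| + 2) * (1 + |κ|) * (C1 * K * Z + C3 * K * Z)) := by
        refine (norm_add_le _ _).trans (add_le_add ?_ ((norm_add_le _ _).trans (add_le_add ?_ ?_)))
        · rw [norm_mul, Complex.norm_real, Real.norm_of_nonneg hβ.le]; gcongr
        · rw [norm_mul, Complex.norm_real, Real.norm_eq_abs]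
          gcongr
          refine (norm_sub_le _ _).trans (add_le_add b1 ?_)
          rw [norm_mul, Complex.norm_ofNat]; gcongr
        · rw [norm_mul]
          refine mul_le_mul (norm_exponent_le a κ) ((norm_sub_le _ _).trans (add_le_add b1 b3))
            (norm_nonneg _) (by positivity)
    _ = (β * C1 + |γ| * (C1 + 2 * C2)) * (K * 1) * Z + (|a| + 2) * (C1 + C3) * (K * (1 + |κ|)) * Z := by ring
    _ ≤ (β * C1 + |γ| * (C1 + 2 * C2)) * (K * (1 + |κ|)) * Z +
        (|a| + 2) * (C1 + C3) * (K * (1 + |κ|)) * Z := by gcongr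
    _ = _ := by rw [pow_succ]; ring

theorem radialLaplaceBound_half_nat : ∀ n : ℕ, 1 ≤ n → RadialLaplaceBound ((n : ℝ) / 2)
  | 0, h => absurd h (by norm_num)
  | 1, _ => by simpa using radialLaplaceBound_half
  | 2, _ => by simpa using radialLaplaceBound_one
  | n + 3, _ => by
    have := (radialLaplaceBound_half_nat (n + 1) (by omega)).add_one (by positivity)
    convert this using 1
    push_cast
    ring

theorem hasDerivAt_radialLaplace {β γ a κ : ℝ} {z : ℂ} (hγ : γ + a ≤ -(3 / 2)) (hβ : 0 < β) (hz : 0 < z.re) :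
    HasDerivAt (radialLaplace β γ a κ) (-radialLaplace (β + 1) γ a κ z) z := by
  have hz2 : 0 < z.re / 2 := by positivity
  have hball : ∀ w ∈ Metric.ball z (z.re / 2), z.re / 2 < w.re := fun w hw => by
    have := (Complex.abs_re_le_norm (w - z)).trans_lt (mem_ball_iff_norm.1 hw)
    rw [Complex.sub_re, abs_lt] at this
    linarith
  have h := hasDerivAt_integral_of_dominated_loc_of_deriv_le
    (μ := volume.restrict (Set.Ioi (0 : ℝ)))
    (F := fun (w : ℂ) (v : ℝ) => Complex.exp (-w * v) * ((v ^ (β - 1) : ℝ) : ℂ) * radialAmp γ a κ v)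
    (F' := fun (w : ℂ) (v : ℝ) => -(Complex.exp (-w * v) * ((v ^ (β + 1 - 1) : ℝ) : ℂ) * radialAmp γ a κ v))
    (bound := fun v => Real.exp (-(z.re / 2) * v) * v ^ (β + 1 - 1) * 2 ^ |γ|)
    (x₀ := z) (Metric.ball_mem_nhds z hz2)
    (Filter.Eventually.of_forall fun w => aestronglyMeasurable_laplace (continuousOn_radialAmp γ a κ) β w)
    (integrableOn_radialLaplace hγ hβ hz)
    (aestronglyMeasurable_laplace (continuousOn_radialAmp γ a κ) (β + 1) z).neg ?_
    ((integrableOn_rpow_mul_exp (by linarith) hz2).mul_const _) ?_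
  · refine h.2.congr_deriv ?_
    rw [integral_neg, radialLaplace]
  · refine (ae_restrict_iff' measurableSet_Ioi).2 (Filter.Eventually.of_forall fun v hv w hw => ?_)
    have hv0 : (0 : ℝ) < v := hv
    rw [norm_neg, norm_mul, norm_mul, norm_exp_neg_mul_ofReal, Complex.norm_real,
      Real.norm_of_nonneg (by positivity)]
    have h1 := norm_radialAmp_le_const (κ := κ) hv0.le hγ
    have h2 := hball w hw
    have h3 : Real.exp (-w.re * v) ≤ Real.exp (-(z.re / 2) * v) := Real.exp_le_exp.2 (by nlinarith)
    gcongr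
  · refine (ae_restrict_iff' measurableSet_Ioi).2 (Filter.Eventually.of_forall fun v hv w hw => ?_)
    have hv0 : (0 : ℝ) < v := hv
    have hp : ((v ^ (β + 1 - 1) : ℝ) : ℂ) = ((v ^ (β - 1) : ℝ) : ℂ) * v := by
      rw [← Complex.ofReal_mul, ← Real.rpow_add_one hv0.ne']; congr 2; ring
    have h1 : HasDerivAt (fun w : ℂ => Complex.exp (-w * v)) (Complex.exp (-w * v) * (-1 * v)) w :=
      (((hasDerivAt_id w).neg).mul_const (v : ℂ)).cexp
    refine ((h1.mul_const _).mul_const _).congr_deriv ?_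
    rw [hp]; ring

/-- After removal of its decay, the Laplace transform is a symbol of order zero: bounded, with
derivative of size `|z|^{-2}`. The derivative gains because `βL_β - zL_{β+1}` only involves the
derivative of the amplitude. -/
theorem exists_radialLaplace_symbol {β γ a : ℝ} (hβ : 0 < β) (hγ : γ + a ≤ -(3 / 2))
    (hB : RadialLaplaceBound β) :
    ∃ C : ℝ, 0 ≤ C ∧ ∃ N : ℕ, ∀ κ : ℝ,
      DifferentiableOn ℂ (fun z => z ^ (β : ℂ) * radialLaplace β γ a κ z) {z | 0 < z.re} ∧
      (∀ z : ℂ, 0 < z.re → ‖z ^ (β : ℂ) * radialLaplace β γ a κ z‖ ≤ C * (1 + |κ|) ^ N) ∧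
      ∀ z : ℂ, 0 < z.re → ‖deriv (fun z => z ^ (β : ℂ) * radialLaplace β γ a κ z) z‖ ≤
        C * (1 + |κ|) ^ N / ‖z‖ ^ 2 := by
  obtain ⟨C1, hC1, N1, h1⟩ := hB γ a hγ
  obtain ⟨C2, hC2, N2, h2⟩ := hB.add_one hβ (γ - 1) a (by linarith)
  obtain ⟨C3, hC3, N3, h3⟩ := hB.add_one hβ γ (a - 1) (by linarith)
  refine ⟨C1 + |γ| * C2 + (|a| + 2) * C3, by positivity, N1 + N2 + N3 + 1, fun κ => ?_⟩
  have hκ : 1 ≤ 1 + |κ| := by have := abs_nonneg κ; linarith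
  set K := (1 + |κ|) ^ (N1 + N2 + N3 + 1) with hK
  have p1 : (1 + |κ|) ^ N1 ≤ K := pow_le_pow_right₀ hκ (by omega)
  have p2 : (1 + |κ|) ^ N2 ≤ K := pow_le_pow_right₀ hκ (by omega)
  have p3 : (1 + |κ|) * (1 + |κ|) ^ N3 ≤ K := by
    rw [← pow_succ']; exact pow_le_pow_right₀ hκ (by omega)
  have hd : ∀ z : ℂ, 0 < z.re → HasDerivAt (fun z => z ^ (β : ℂ) * radialLaplace β γ a κ z)
      (-(z ^ ((β - 1 : ℝ) : ℂ) * (γ * radialLaplace (β + 1) (γ - 1) a κ z +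
        ((a : ℂ) - 2 * Complex.I * κ) * radialLaplace (β + 1) γ (a - 1) κ z))) z := fun z hz => by
    have hz0 : z ≠ 0 := by rintro rfl; simp at hz
    have e1 : HasDerivAt (fun z : ℂ => z ^ (β : ℂ)) ((β : ℂ) * z ^ ((β : ℂ) - 1) * 1) z :=
      (hasDerivAt_id z).cpow_const (Or.inl hz)
    refine (e1.mul (hasDerivAt_radialLaplace (κ := κ) hγ hβ hz)).congr_deriv ?_
    have key := mul_radialLaplace_add_one (κ := κ) hγ hβ hz
    have hp : z ^ (β : ℂ) = z ^ ((β : ℂ) - 1) * z := by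
      rw [Complex.cpow_sub _ _ hz0, Complex.cpow_one]; field_simp
    rw [hp]
    push_cast
    linear_combination (-z ^ ((β : ℂ) - 1)) * key
  refine ⟨fun z hz => (hd z hz).differentiableAt.differentiableWithinAt, fun z hz => ?_, fun z hz => ?_⟩
  · have hzp := norm_pos_of_re_pos hz
    rw [norm_mul, Complex.norm_cpow_real]
    calc _ ≤ ‖z‖ ^ β * (C1 * (1 + |κ|) ^ N1 * ‖z‖ ^ (-β)) := by gcongr; exact h1 κ z hz
      _ = C1 * (1 + |κ|) ^ N1 := by
        rw [Real.rpow_neg hzp.le]; have := Real.rpow_pos_of_pos hzp β; field_simp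
      _ ≤ (C1 + |γ| * C2 + (|a| + 2) * C3) * K := by
        refine mul_le_mul ?_ p1 (by positivity) (by positivity)
        have : 0 ≤ |γ| * C2 + (|a| + 2) * C3 := by positivity
        linarith
  · have hzp := norm_pos_of_re_pos hz
    rw [(hd z hz).deriv, norm_neg, norm_mul, Complex.norm_cpow_real]
    set Z := ‖z‖ ^ (-(β + 1)) with hZ
    have hZ0 : 0 ≤ Z := by positivity
    have hin : ‖(γ : ℂ) * radialLaplace (β + 1) (γ - 1) a κ z +
        ((a : ℂ) - 2 * Complex.I * κ) * radialLaplace (β + 1) γ (a - 1) κ z‖ ≤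
        (C1 + |γ| * C2 + (|a| + 2) * C3) * K * Z := by
      calc _ ≤ |γ| * (C2 * (1 + |κ|) ^ N2 * Z) + (|a| + 2) * (1 + |κ|) * (C3 * (1 + |κ|) ^ N3 * Z) := by
            refine (norm_add_le _ _).trans (add_le_add ?_ ?_)
            · rw [norm_mul, Complex.norm_real, Real.norm_eq_abs]; gcongr; exact h2 κ z hz
            · rw [norm_mul]
              exact mul_le_mul (norm_exponent_le a κ) (h3 κ z hz) (norm_nonneg _) (by positivity)
        _ = |γ| * C2 * (1 + |κ|) ^ N2 * Z + (|a| + 2) * C3 * ((1 + |κ|) * (1 + |κ|) ^ N3) * Z := by ring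
        _ ≤ |γ| * C2 * K * Z + (|a| + 2) * C3 * K * Z := by gcongr
        _ ≤ C1 * K * Z + (|γ| * C2 * K * Z + (|a| + 2) * C3 * K * Z) := le_add_of_nonneg_left (by positivity)
        _ = _ := by ring
    calc _ ≤ ‖z‖ ^ (β - 1) * ((C1 + |γ| * C2 + (|a| + 2) * C3) * K * Z) := by gcongr
      _ = (C1 + |γ| * C2 + (|a| + 2) * C3) * K * (‖z‖ ^ (β - 1) * Z) := by ring
      _ = _ := by
        rw [hZ, ← Real.rpow_add hzp, show β - 1 + -(β + 1) = -(2 : ℕ) by push_cast; ring,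
          Real.rpow_neg hzp.le, Real.rpow_natCast, div_eq_mul_inv]

/-! ### Slicing transversally to the direction of `x` -/

/-- `ℝ × ℝⁿ` with its Euclidean structure, isometric to `ℝⁿ⁺¹` in such a way that `x` lies on the positive
first axis. -/
theorem exists_isometry_prod_map_eq {n : ℕ} (x : EuclideanSpace ℝ (Fin (n + 1))) :
    ∃ T : WithLp 2 (ℝ × EuclideanSpace ℝ (Fin n)) ≃ₗᵢ[ℝ] EuclideanSpace ℝ (Fin (n + 1)),
      T (WithLp.toLp 2 (‖x‖, 0)) = x := by
  have hf : Module.finrank ℝ (WithLp 2 (ℝ × EuclideanSpace ℝ (Fin n))) = n + 1 := by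
    rw [(WithLp.linearEquiv 2 ℝ (ℝ × EuclideanSpace ℝ (Fin n))).finrank_eq]
    simp [add_comm]
  let T0 := ((stdOrthonormalBasis ℝ (WithLp 2 (ℝ × EuclideanSpace ℝ (Fin n)))).reindex (finCongr hf)).repr
  have hn : ‖T0 (WithLp.toLp 2 (‖x‖, 0))‖ = ‖x‖ := by
    rw [LinearIsometryEquiv.norm_map, WithLp.prod_norm_eq_of_L2]
    simp
  exact ⟨T0.trans (Submodule.reflection (Submodule.span ℝ {T0 (WithLp.toLp 2 (‖x‖, 0)) - x})ᗮ),
    Submodule.reflection_sub hn⟩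

theorem integral_euclideanSpace_succ {n : ℕ} {T : WithLp 2 (ℝ × EuclideanSpace ℝ (Fin n)) ≃ₗᵢ[ℝ]
    EuclideanSpace ℝ (Fin (n + 1))} {f : EuclideanSpace ℝ (Fin (n + 1)) → ℂ} (hf : Integrable f) :
    ∫ ξ, f ξ = ∫ η : ℝ, ∫ ρ : EuclideanSpace ℝ (Fin n), f (T (WithLp.toLp 2 (η, ρ))) := by
  have h1 := T.measurePreserving
  have h2 := WithLp.volume_preserving_toLp ℝ (EuclideanSpace ℝ (Fin n))
  have e2 : MeasurableEmbedding (WithLp.toLp 2 : ℝ × EuclideanSpace ℝ (Fin n) → _) :=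
    (MeasurableEquiv.toLp 2 (ℝ × EuclideanSpace ℝ (Fin n))).measurableEmbedding
  have e1 : MeasurableEmbedding T := T.toHomeomorph.measurableEmbedding
  have hi : Integrable (fun p : ℝ × EuclideanSpace ℝ (Fin n) => f (T (WithLp.toLp 2 p))) :=
    h2.integrable_comp_of_integrable (h1.integrable_comp_of_integrable hf)
  rw [← h1.integral_comp e1, ← h2.integral_comp e2]
  exact integral_prod _ hi

/-- The multiplier `e^{-(δ-it)⟨ξ⟩} ⟨ξ⟩^{-(d+2)/2 - 2iκ}`. -/
noncomputable def kgSymbol {d : ℕ} (κ δ t : ℝ) (ξ : EuclideanSpace ℝ (Fin d)) : ℂ :=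
  Complex.exp (-dampedTime δ t * japaneseBracket ξ) *
    ((1 + ‖ξ‖ ^ 2 : ℝ) : ℂ) ^ (-((d : ℂ) + 2) / 4 - Complex.I * (κ : ℂ))

theorem continuous_kgSymbol {d : ℕ} (κ δ t : ℝ) :
    Continuous (kgSymbol κ δ t : EuclideanSpace ℝ (Fin d) → ℂ) := by
  have hj : Continuous (japaneseBracket : EuclideanSpace ℝ (Fin d) → ℝ) := by
    unfold japaneseBracket; fun_prop
  unfold kgSymbol
  refine (by fun_prop : Continuous fun ξ : EuclideanSpace ℝ (Fin d) =>
    Complex.exp (-dampedTime δ t * japaneseBracket ξ)).mul ?_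
  refine Continuous.cpow (by fun_prop) continuous_const fun ξ => ?_
  left
  rw [Complex.ofReal_re]
  positivity

theorem norm_kgSymbol_le {d : ℕ} (κ δ t : ℝ) (ξ : EuclideanSpace ℝ (Fin d)) :
    ‖kgSymbol κ δ t ξ‖ ≤ Real.exp (-δ * japaneseBracket ξ) := by
  rw [kgSymbol, norm_mul, norm_exp_neg_mul_ofReal, dampedTime_re]
  refine mul_le_of_le_one_right (Real.exp_pos _).le ?_
  rw [Complex.norm_cpow_eq_rpow_re_of_pos (by positivity)]
  refine Real.rpow_le_one_of_one_le_of_nonpos (by nlinarith [sq_nonneg ‖ξ‖]) ?_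
  have : (-((d : ℂ) + 2) / 4 - Complex.I * (κ : ℂ)).re = -((d : ℝ) + 2) / 4 := by
    have : (-((d : ℂ) + 2) / 4 - Complex.I * (κ : ℂ)) = ((-((d : ℝ) + 2) / 4 : ℝ) : ℂ) - Complex.I * (κ : ℂ) := by
      push_cast; ring
    rw [this]; simp
  rw [this, neg_div]
  simp only [Left.neg_nonpos_iff]; positivity

theorem norm_le_japaneseBracket {d : ℕ} (ξ : EuclideanSpace ℝ (Fin d)) : ‖ξ‖ ≤ japaneseBracket ξ :=
  Real.le_sqrt_of_sq_le (by linarith)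

theorem one_le_japaneseBracket {d : ℕ} (ξ : EuclideanSpace ℝ (Fin d)) : 1 ≤ japaneseBracket ξ :=
  Real.one_le_sqrt.2 (by nlinarith [sq_nonneg ‖ξ‖])

theorem integrable_exp_neg_mul_japaneseBracket {d : ℕ} {δ : ℝ} (hδ : 0 < δ) :
    Integrable fun ξ : EuclideanSpace ℝ (Fin d) => Real.exp (-δ * japaneseBracket ξ) := by
  have hj : Continuous (japaneseBracket : EuclideanSpace ℝ (Fin d) → ℝ) := by
    unfold japaneseBracket; fun_prop
  have h0 := integrable_one_add_norm (E := EuclideanSpace ℝ (Fin d)) (μ := volume) (r := d + 1) (by simp)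
  refine (h0.const_mul ((d + 1).factorial / (δ / 2) ^ (d + 1))).mono'
    (by fun_prop) (Filter.Eventually.of_forall fun ξ => ?_)
  have h1 := norm_le_japaneseBracket ξ
  have h2 := one_le_japaneseBracket ξ
  have hn := norm_nonneg ξ
  -- `1 + ‖ξ‖ ≤ 2⟨ξ⟩` and `y^k / k! ≤ e^y`
  have h3 : (δ / 2 * (1 + ‖ξ‖)) ^ (d + 1) / (d + 1).factorial ≤ Real.exp (δ * japaneseBracket ξ) :=
    (Real.pow_div_factorial_le_exp _ (by positivity) _).trans (Real.exp_le_exp.2 (by nlinarith))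
  rw [Real.norm_of_nonneg (Real.exp_pos _).le, neg_mul, Real.exp_neg, Real.rpow_neg (by positivity)]
  have h4 : (1 + ‖ξ‖) ^ ((d : ℝ) + 1) = (1 + ‖ξ‖) ^ (d + 1) := by
    rw [← Real.rpow_natCast]; push_cast; rfl
  rw [h4, ← div_eq_mul_inv, inv_le_comm₀ (Real.exp_pos _) (by positivity)]
  refine le_trans (le_of_eq ?_) h3
  rw [mul_pow]
  have : ((d + 1).factorial : ℝ) ≠ 0 := by positivity
  field_simp

theorem integrable_kgSymbol {d : ℕ} {δ : ℝ} (hδ : 0 < δ) (κ t : ℝ) :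
    Integrable (kgSymbol κ δ t : EuclideanSpace ℝ (Fin d) → ℂ) :=
  (integrable_exp_neg_mul_japaneseBracket hδ).mono' (continuous_kgSymbol κ δ t).aestronglyMeasurable
    (Filter.Eventually.of_forall (norm_kgSymbol_le κ δ t))

/-- The transverse integral `∫_{ℝⁿ} e^{-z⟨y⟩} ⟨y⟩^{-(n+3)/2 - 2iκ} dy`. -/
noncomputable def transverseIntegral (n : ℕ) (κ : ℝ) (z : ℂ) : ℂ :=
  ∫ y : EuclideanSpace ℝ (Fin n), Complex.exp (-z * japaneseBracket y) *
    ((1 + ‖y‖ ^ 2 : ℝ) : ℂ) ^ (-((n : ℂ) + 3) / 4 - Complex.I * (κ : ℂ))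

/-- The transverse integral in polar coordinates, with `v = ⟨y⟩ - 1` as radial variable. -/
theorem transverseIntegral_eq {n : ℕ} (hn : 1 ≤ n) (κ : ℝ) (z : ℂ) :
    transverseIntegral n κ z = ((n * (volume : Measure (EuclideanSpace ℝ (Fin n))).real (Metric.ball 0 1) : ℝ) : ℂ) *
      (Complex.exp (-z) * radialLaplace ((n : ℝ) / 2) ((n : ℝ) / 2 - 1) (-((n : ℝ) + 1) / 2) κ z) := by
  have : Nonempty (Fin n) := ⟨⟨0, hn⟩⟩
  have h := integral_fun_norm_addHaar (volume : Measure (EuclideanSpace ℝ (Fin n)))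
    (fun r : ℝ => Complex.exp (-z * √(1 + r ^ 2)) * ((1 + r ^ 2 : ℝ) : ℂ) ^ (-((n : ℂ) + 3) / 4 - Complex.I * (κ : ℂ)))
  rw [transverseIntegral]
  simp only [japaneseBracket]
  rw [h, finrank_euclideanSpace_fin]
  rw [nsmul_eq_mul, Complex.real_smul]
  push_cast
  rw [mul_assoc]
  congr 2
  have himg : (fun v : ℝ => √(v ^ 2 + 2 * v)) '' Set.Ioi 0 = Set.Ioi 0 := by
    ext r
    constructor
    · rintro ⟨v, hv, rfl⟩
      have hv0 : (0 : ℝ) < v := hv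
      exact Real.sqrt_pos.2 (by positivity)
    · intro hr
      have hr0 : (0 : ℝ) < r := hr
      refine ⟨√(1 + r ^ 2) - 1, ?_, ?_⟩
      · have : 1 < √(1 + r ^ 2) := Real.lt_sqrt_of_sq_lt (by nlinarith)
        exact sub_pos.2 this
      · have := Real.sq_sqrt (by positivity : 0 ≤ 1 + r ^ 2)
        have e : (√(1 + r ^ 2) - 1) ^ 2 + 2 * (√(1 + r ^ 2) - 1) = r ^ 2 := by nlinarith
        simp only [e]
        exact Real.sqrt_sq hr0.le
  have hinj : Set.InjOn (fun v : ℝ => √(v ^ 2 + 2 * v)) (Set.Ioi 0) := by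
    intro u hu v hv huv
    have hu0 : (0 : ℝ) < u := hu
    have hv0 : (0 : ℝ) < v := hv
    have := (Real.sqrt_inj (by positivity) (by positivity)).1 huv
    have h2 : (u - v) * (u + v + 2) = 0 := by linarith
    rcases mul_eq_zero.1 h2 with h | h
    · linarith
    · linarith
  have hder : ∀ v ∈ Set.Ioi (0 : ℝ), HasDerivWithinAt (fun v : ℝ => √(v ^ 2 + 2 * v))
      ((1 + v) / √(v ^ 2 + 2 * v)) (Set.Ioi 0) v := fun v hv => by
    have hv0 : (0 : ℝ) < v := hv
    have h1 : HasDerivAt (fun v : ℝ => v ^ 2 + 2 * v) (2 * v + 2) v := by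
      refine ((hasDerivAt_pow 2 v).add ((hasDerivAt_id v).const_mul 2)).congr_deriv ?_
      simp
    refine (h1.sqrt (by positivity)).hasDerivWithinAt.congr_deriv ?_
    have : 0 < √(v ^ 2 + 2 * v) := Real.sqrt_pos.2 (by positivity)
    field_simp
    ring
  have key := integral_image_eq_integral_abs_deriv_smul measurableSet_Ioi hder hinj
    (fun r : ℝ => r ^ (n - 1) • (Complex.exp (-z * √(1 + r ^ 2)) *
      ((1 + r ^ 2 : ℝ) : ℂ) ^ (-((n : ℂ) + 3) / 4 - Complex.I * (κ : ℂ))))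
  rw [himg] at key
  rw [radialLaplace, ← integral_const_mul]
  push_cast at key ⊢
  rw [key]
  refine setIntegral_congr_fun measurableSet_Ioi fun v hv => ?_
  have hv0 : (0 : ℝ) < v := hv
  have hs0 : 0 < √(v ^ 2 + 2 * v) := Real.sqrt_pos.2 (by positivity)
  have hss : √(v ^ 2 + 2 * v) ^ 2 = v ^ 2 + 2 * v := Real.sq_sqrt (by positivity)
  have hv1 : (0 : ℝ) < 1 + v := by positivity
  have hsq : √(1 + √(v ^ 2 + 2 * v) ^ 2) = 1 + v := by
    rw [hss, show 1 + (v ^ 2 + 2 * v) = (1 + v) ^ 2 by ring, Real.sqrt_sq hv1.le]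
  have hpow : √(v ^ 2 + 2 * v) ^ (n - 1) / √(v ^ 2 + 2 * v) = v ^ ((n : ℝ) / 2 - 1) * (2 + v) ^ ((n : ℝ) / 2 - 1) := by
    rw [← Real.mul_rpow hv0.le (by positivity), Real.sqrt_eq_rpow, ← Real.rpow_natCast, ← Real.rpow_mul (by positivity),
      ← Real.rpow_sub (by positivity)]
    rw [show v ^ 2 + 2 * v = v * (2 + v) by ring]
    congr 1
    rw [Nat.cast_sub hn]
    push_cast
    ring
  have hcp : (1 + v : ℂ) * ((1 : ℂ) + ((√(v ^ 2 + 2 * v) : ℝ) : ℂ) ^ 2) ^ (-((n : ℂ) + 3) / 4 - Complex.I * (κ : ℂ)) =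
      ((1 + v : ℝ) : ℂ) ^ (((-((n : ℝ) + 1) / 2 : ℝ) : ℂ) - 2 * Complex.I * κ) := by
    have h1 : ((1 : ℂ) + ((√(v ^ 2 + 2 * v) : ℝ) : ℂ) ^ 2) = (((1 + v) ^ 2 : ℝ) : ℂ) := by
      rw [← Complex.ofReal_pow, hss]; push_cast; ring
    have h2 : (1 + v : ℂ) = ((1 + v : ℝ) : ℂ) := by push_cast; rfl
    have h3 : ((1 + v : ℝ) : ℂ) ≠ 0 := Complex.ofReal_ne_zero.2 hv1.ne'
    have h4 : (((1 + v) ^ 2 : ℝ) : ℂ) ≠ 0 := Complex.ofReal_ne_zero.2 (by positivity)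
    rw [h1, h2, Complex.cpow_def_of_ne_zero h4, Complex.cpow_def_of_ne_zero h3, ← Complex.ofReal_log (by positivity),
      ← Complex.ofReal_log hv1.le, Real.log_pow]
    nth_rw 1 [← Real.exp_log hv1]
    rw [Complex.ofReal_exp, ← Complex.exp_add]
    congr 1
    push_cast
    ring
  simp only [radialAmp, Complex.real_smul]
  rw [← hcp]
  rw [hsq, abs_of_pos (by positivity)]
  have e : (((1 + v) / √(v ^ 2 + 2 * v) : ℝ) : ℂ) * ((√(v ^ 2 + 2 * v) : ℂ) ^ (n - 1)) =
      (1 + v : ℂ) * ((v ^ ((n : ℝ) / 2 - 1) : ℝ) : ℂ) * (((2 + v) ^ ((n : ℝ) / 2 - 1) : ℝ) : ℂ) := by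
    rw [mul_assoc, ← Complex.ofReal_mul, ← hpow]
    push_cast
    ring
  have e2 : Complex.exp (-z * ((1 + v : ℝ) : ℂ)) = Complex.exp (-z) * Complex.exp (-z * v) := by
    rw [← Complex.exp_add]; congr 1; push_cast; ring
  rw [e2]
  push_cast at e ⊢
  linear_combination (Complex.exp (-z) * Complex.exp (-z * v) *
    ((1 : ℂ) + ((√(v ^ 2 + 2 * v) : ℝ) : ℂ) ^ 2) ^ (-((n : ℂ) + 3) / 4 - Complex.I * (κ : ℂ))) * e

/-- The transverse integral is `e^{-z} z^{-n/2}` times a symbol of order zero. -/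
theorem exists_transverseIntegral_symbol (n : ℕ) :
    ∃ C : ℝ, 0 ≤ C ∧ ∃ N : ℕ, ∀ κ : ℝ, ∃ b : ℂ → ℂ, DifferentiableOn ℂ b {z | 0 < z.re} ∧
      (∀ z : ℂ, 0 < z.re → ‖b z‖ ≤ C * (1 + |κ|) ^ N) ∧
      (∀ z : ℂ, 0 < z.re → ‖deriv b z‖ ≤ C * (1 + |κ|) ^ N / ‖z‖ ^ 2) ∧
      ∀ z : ℂ, 0 < z.re → transverseIntegral n κ z = Complex.exp (-z) * z ^ (-(n : ℂ) / 2) * b z := by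
  rcases Nat.eq_zero_or_pos n with rfl | hn
  · refine ⟨1, zero_le_one, 0, fun κ => ⟨fun _ => 1, by fun_prop, by simp, fun z _ => ?_, fun z _ => ?_⟩⟩
    · simp
    · have hv : (volume : Measure (EuclideanSpace ℝ (Fin 0))) = Measure.dirac 0 :=
        volume_euclideanSpace_eq_dirac _
      rw [transverseIntegral, hv, integral_dirac]
      simp [japaneseBracket]
  · obtain ⟨C, hC, N, h⟩ := exists_radialLaplace_symbol (β := (n : ℝ) / 2) (γ := (n : ℝ) / 2 - 1)
      (a := -((n : ℝ) + 1) / 2) (by positivity) (by linarith) (radialLaplaceBound_half_nat n hn)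
    set c : ℝ := n * (volume : Measure (EuclideanSpace ℝ (Fin n))).real (Metric.ball 0 1) with hc
    have hc0 : 0 ≤ c := by positivity
    clear_value c
    refine ⟨c * C, by positivity, N, fun κ => ?_⟩
    obtain ⟨hd, hb, hb'⟩ := h κ
    refine ⟨fun z => (c : ℂ) * (z ^ (((n : ℝ) / 2 : ℝ) : ℂ) *
      radialLaplace ((n : ℝ) / 2) ((n : ℝ) / 2 - 1) (-((n : ℝ) + 1) / 2) κ z), hd.const_mul _,
      fun z hz => ?_, fun z hz => ?_, fun z hz => ?_⟩
    · rw [norm_mul, Complex.norm_real, Real.norm_of_nonneg hc0, mul_assoc]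
      gcongr
      exact hb z hz
    · rw [deriv_const_mul_field, norm_mul, Complex.norm_real, Real.norm_of_nonneg hc0, mul_assoc, mul_div_assoc]
      gcongr
      exact hb' z hz
    · have hz0 : z ≠ 0 := by rintro rfl; simp at hz
      rw [transverseIntegral_eq hn]
      have : z ^ (-(n : ℂ) / 2) * z ^ (((n : ℝ) / 2 : ℝ) : ℂ) = 1 := by
        rw [← Complex.cpow_add _ _ hz0]
        push_cast
        rw [show -(n : ℂ) / 2 + (n : ℂ) / 2 = 0 by ring, Complex.cpow_zero]
      simp only [← hc]
      linear_combination (-(c : ℂ) * Complex.exp (-z) *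
        radialLaplace ((n : ℝ) / 2) ((n : ℝ) / 2 - 1) (-((n : ℝ) + 1) / 2) κ z) * this

theorem cpow_ofReal_eq_exp {m : ℝ} (hm : 0 < m) (c : ℂ) : ((m : ℝ) : ℂ) ^ c = Complex.exp (Real.log m * c) := by
  rw [Complex.cpow_def_of_ne_zero (Complex.ofReal_ne_zero.2 hm.ne'), Complex.ofReal_log hm.le]

/-- Integrating the multiplier over a transverse hyperplane leaves a one-dimensional multiplier in
`⟨η⟩`: the dilation `ρ = ⟨η⟩ y` turns `⟨(η, ρ)⟩` into `⟨η⟩⟨y⟩`. -/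
theorem integral_kgSymbol_slice {n : ℕ} {δ t : ℝ} (hδ : 0 < δ) (κ X : ℝ) {b : ℂ → ℂ}
    (hb : ∀ z : ℂ, 0 < z.re → transverseIntegral n κ z = Complex.exp (-z) * z ^ (-(n : ℂ) / 2) * b z)
    (T : WithLp 2 (ℝ × EuclideanSpace ℝ (Fin n)) ≃ₗᵢ[ℝ] EuclideanSpace ℝ (Fin (n + 1))) (η : ℝ) :
    ∫ ρ : EuclideanSpace ℝ (Fin n), Complex.exp (Complex.I * ((X * η : ℝ) : ℂ)) *
      kgSymbol κ δ t (T (WithLp.toLp 2 (η, ρ))) =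
    dampedTime δ t ^ (-(n : ℂ) / 2) * modelIntegrand κ X δ t b η := by
  set m := bracket η with hm
  have hm0 : 0 < m := bracket_pos η
  have hms : m ^ 2 = 1 + η ^ 2 := bracket_sq η
  have hζ0 : dampedTime δ t ≠ 0 := fun h => by
    have := dampedTime_re δ t; rw [h] at this; simp at this; linarith
  have hnorm : ∀ ρ : EuclideanSpace ℝ (Fin n), ‖T (WithLp.toLp 2 (η, ρ))‖ ^ 2 = η ^ 2 + ‖ρ‖ ^ 2 := fun ρ => by
    rw [LinearIsometryEquiv.norm_map, WithLp.prod_norm_sq_eq_of_L2]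
    simp
  have hscale := Measure.integral_comp_smul_of_nonneg (volume : Measure (EuclideanSpace ℝ (Fin n)))
    (fun ρ => kgSymbol κ δ t (T (WithLp.toLp 2 (η, ρ)))) m (hR := hm0.le)
  have hpt : ∀ y : EuclideanSpace ℝ (Fin n), kgSymbol κ δ t (T (WithLp.toLp 2 (η, m • y))) =
      ((m : ℝ) : ℂ) ^ (2 * (-((n : ℂ) + 3) / 4 - Complex.I * (κ : ℂ))) *
        (Complex.exp (-(dampedTime δ t * m) * japaneseBracket y) *
          ((1 + ‖y‖ ^ 2 : ℝ) : ℂ) ^ (-((n : ℂ) + 3) / 4 - Complex.I * (κ : ℂ))) := fun y => by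
    have e1 : 1 + ‖T (WithLp.toLp 2 (η, m • y))‖ ^ 2 = m ^ 2 * (1 + ‖y‖ ^ 2) := by
      rw [hnorm, norm_smul, mul_pow, Real.norm_eq_abs, sq_abs]; linarith
    have e2 : japaneseBracket (T (WithLp.toLp 2 (η, m • y))) = m * japaneseBracket y := by
      rw [japaneseBracket, e1, Real.sqrt_mul (by positivity), Real.sqrt_sq hm0.le, japaneseBracket]
    have hy : 0 < 1 + ‖y‖ ^ 2 := by positivity
    rw [kgSymbol, e2, e1, cpow_ofReal_eq_exp (by positivity), cpow_ofReal_eq_exp hy, cpow_ofReal_eq_exp hm0,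
      Real.log_mul (by positivity) hy.ne', Real.log_pow, ← Complex.exp_add, ← Complex.exp_add, ← Complex.exp_add]
    congr 1
    push_cast
    ring
  simp only [hpt] at hscale
  rw [integral_const_mul, ← transverseIntegral, hb _ (dampedTime_mul_bracket_re_pos hδ t η),
    finrank_euclideanSpace_fin] at hscale
  rw [integral_const_mul]
  have h2 : ∫ ρ : EuclideanSpace ℝ (Fin n), kgSymbol κ δ t (T (WithLp.toLp 2 (η, ρ))) =
      ((m ^ n : ℝ) : ℂ) * (((m : ℝ) : ℂ) ^ (2 * (-((n : ℂ) + 3) / 4 - Complex.I * (κ : ℂ))) *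
        (Complex.exp (-(dampedTime δ t * m)) * (dampedTime δ t * m) ^ (-(n : ℂ) / 2) * b (dampedTime δ t * m))) := by
    rw [hscale, Complex.real_smul, ← mul_assoc, ← Complex.ofReal_mul, mul_inv_cancel₀ (pow_ne_zero n hm0.ne')]
    simp
  rw [h2, modelIntegrand, ← hm]
  have e3 : (dampedTime δ t * m) ^ (-(n : ℂ) / 2) =
      dampedTime δ t ^ (-(n : ℂ) / 2) * Complex.exp (Real.log m * (-(n : ℂ) / 2)) := by
    rw [Complex.cpow_def_of_ne_zero (mul_ne_zero hζ0 (Complex.ofReal_ne_zero.2 hm0.ne')),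
      Complex.cpow_def_of_ne_zero hζ0, Complex.log_mul_ofReal _ hm0 _ hζ0, ← Complex.exp_add]
    congr 1; ring
  have e4 : ((m ^ n : ℝ) : ℂ) = Complex.exp (Real.log m * n) := by
    rw [← cpow_ofReal_eq_exp hm0, Complex.cpow_natCast]; push_cast; rfl
  have e5 : ((m ^ (-(3 / 2) : ℝ) : ℝ) : ℂ) = Complex.exp (Real.log m * (-(3 / 2) : ℂ)) := by
    rw [Real.rpow_def_of_pos hm0]; push_cast; rfl
  rw [e3, e4, e5, cpow_ofReal_eq_exp hm0, Complex.ofReal_exp]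
  have e6 : Complex.exp (Complex.I * ((X * η : ℝ) : ℂ)) * Complex.exp (Real.log m * n) *
      Complex.exp (Real.log m * (2 * (-((n : ℂ) + 3) / 4 - Complex.I * (κ : ℂ)))) *
      Complex.exp (-(dampedTime δ t * m)) * Complex.exp (Real.log m * (-(n : ℂ) / 2)) =
      Complex.exp (Complex.I * kgPhase κ X t η) * Complex.exp (Real.log m * (-(3 / 2) : ℂ)) *
        Complex.exp ((-(δ * m) : ℝ) : ℂ) := by
    simp only [← Complex.exp_add]
    congr 1
    simp only [kgPhase, dampedTime, ← hm]
    push_cast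
    ring
  linear_combination (dampedTime δ t ^ (-(n : ℂ) / 2) * b (dampedTime δ t * m)) * e6

/-- The dispersive estimate for the multiplier without frequency cutoff, uniformly in the damping. -/
theorem exists_norm_integral_exp_mul_kgSymbol_le (n : ℕ) :
    ∃ C : ℝ, 0 ≤ C ∧ ∃ N : ℕ, ∀ (κ δ t : ℝ) (x : EuclideanSpace ℝ (Fin (n + 1))), 0 < δ → t ≠ 0 →
      ‖∫ ξ, Complex.exp (Complex.I * ((inner ℝ x ξ : ℝ) : ℂ)) * kgSymbol κ δ t ξ‖ ≤
        C * (1 + |κ|) ^ N * |t| ^ (-((n + 1 : ℕ) : ℝ) / 2) := by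
  obtain ⟨C1, hC1, N, h1⟩ := exists_transverseIntegral_symbol n
  obtain ⟨C2, hC2, h2⟩ := exists_norm_integral_modelIntegrand_le
  refine ⟨C2 * C1, by positivity, N + 1, fun κ δ t x hδ ht => ?_⟩
  obtain ⟨b, hbd, hbM, hbM', hb⟩ := h1 κ
  obtain ⟨T, hT⟩ := exists_isometry_prod_map_eq x
  have ht0 : 0 < |t| := abs_pos.2 ht
  have hint : Integrable (fun ξ : EuclideanSpace ℝ (Fin (n + 1)) =>
      Complex.exp (Complex.I * ((inner ℝ x ξ : ℝ) : ℂ)) * kgSymbol κ δ t ξ) := by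
    refine (integrable_kgSymbol hδ κ t).bdd_mul (c := 1) (by fun_prop) (Filter.Eventually.of_forall fun ξ => ?_)
    rw [mul_comm, Complex.norm_exp_ofReal_mul_I]
  have hinner : ∀ (η : ℝ) (ρ : EuclideanSpace ℝ (Fin n)),
      inner ℝ x (T (WithLp.toLp 2 (η, ρ))) = ‖x‖ * η := fun η ρ => by
    conv_lhs => rw [← hT]
    rw [LinearIsometryEquiv.inner_map_map, WithLp.prod_inner_apply]
    simp [mul_comm]
  rw [integral_euclideanSpace_succ (T := T) hint]
  simp only [hinner, integral_kgSymbol_slice hδ κ ‖x‖ hb T]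
  rw [integral_const_mul, norm_mul]
  have hζ := abs_le_norm_dampedTime δ t
  have e1 : ‖dampedTime δ t ^ (-(n : ℂ) / 2)‖ ≤ |t| ^ (-(n : ℝ) / 2) := by
    rw [show (-(n : ℂ) / 2) = ((-(n : ℝ) / 2 : ℝ) : ℂ) by push_cast; rfl, Complex.norm_cpow_real]
    exact Real.rpow_le_rpow_of_nonpos ht0 hζ (by rw [neg_div]; simp only [Left.neg_nonpos_iff]; positivity)
  calc _ ≤ |t| ^ (-(n : ℝ) / 2) * (C2 * (1 + |κ|) * (C1 * (1 + |κ|) ^ N) / √|t|) :=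
        mul_le_mul e1 (h2 κ ‖x‖ δ t _ b hδ ht hbd hbM hbM') (norm_nonneg _) (by positivity)
    _ = C2 * C1 * (1 + |κ|) ^ (N + 1) * (|t| ^ (-(n : ℝ) / 2) * (√|t|)⁻¹) := by ring
    _ = _ := by
      rw [Real.sqrt_eq_rpow, ← Real.rpow_neg ht0.le, ← Real.rpow_add ht0]
      congr 2
      push_cast
      ring

/-! ### Fourier multipliers bounded on suprema, and the frequency cutoff -/

/-- `f` is a Fourier multiplier that increases the supremum of the Fourier transform of an integrable
function at most by the factor `C`. -/
def FourierMultBound {d : ℕ} (f : EuclideanSpace ℝ (Fin d) → ℂ) (C : ℝ) : Prop :=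
  ∀ (H : EuclideanSpace ℝ (Fin d) → ℂ) (B : ℝ), Integrable H →
    (∀ x, ‖∫ ξ, Complex.exp (Complex.I * ((inner ℝ x ξ : ℝ) : ℂ)) * H ξ‖ ≤ B) →
    ∀ x, ‖∫ ξ, Complex.exp (Complex.I * ((inner ℝ x ξ : ℝ) : ℂ)) * (f ξ * H ξ)‖ ≤ C * B

section mult
variable {d : ℕ}

theorem norm_exp_I_mul_ofReal (a : ℝ) : ‖Complex.exp (Complex.I * (a : ℂ))‖ = 1 := by
  rw [mul_comm, Complex.norm_exp_ofReal_mul_I]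

theorem FourierMultBound.mono {f : EuclideanSpace ℝ (Fin d) → ℂ} {C C' : ℝ} (h : FourierMultBound f C)
    (hC : C ≤ C') : FourierMultBound f C' := fun H B hH hB x =>
  (h H B hH hB x).trans (mul_le_mul_of_nonneg_right hC ((norm_nonneg _).trans (hB 0)))

theorem fourierMultBound_character (y : EuclideanSpace ℝ (Fin d)) :
    FourierMultBound (fun ξ => Complex.exp (Complex.I * ((inner ℝ y ξ : ℝ) : ℂ))) 1 := fun H B _ hB x => by
  rw [one_mul]
  refine le_of_eq_of_le ?_ (hB (x + y))
  congr 2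
  ext ξ
  rw [← mul_assoc, ← Complex.exp_add, ← mul_add, inner_add_left, Complex.ofReal_add]

/-- Superpositions of multipliers. -/
theorem FourierMultBound.integral {Ω : Type*} [MeasurableSpace Ω] {μ : Measure Ω} [SFinite μ] {m : Ω → ℂ}
    {c : Ω → ℝ} {f : Ω → EuclideanSpace ℝ (Fin d) → ℂ} (hm : Integrable m μ)
    (hmc : Integrable (fun ω => ‖m ω‖ * c ω) μ) (hf : Measurable (Function.uncurry f))
    (hf1 : ∀ᵐ ω ∂μ, ∀ ξ, ‖f ω ξ‖ ≤ 1) (h : ∀ᵐ ω ∂μ, FourierMultBound (f ω) (c ω)) :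
    FourierMultBound (fun ξ => ∫ ω, m ω * f ω ξ ∂μ) (∫ ω, ‖m ω‖ * c ω ∂μ) := fun H B hH hB x => by
  set G : EuclideanSpace ℝ (Fin d) → ℂ := fun ξ => Complex.exp (Complex.I * ((inner ℝ x ξ : ℝ) : ℂ)) * H ξ with hG
  have hGi : Integrable G := hH.bdd_mul (c := 1) (by fun_prop)
    (Filter.Eventually.of_forall fun ξ => (norm_exp_I_mul_ofReal _).le)
  have hint : Integrable (fun p : EuclideanSpace ℝ (Fin d) × Ω => G p.1 * m p.2 * f p.2 p.1) (volume.prod μ) := by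
    have h0 := hGi.mul_prod hm
    have hfm : AEStronglyMeasurable (fun p : EuclideanSpace ℝ (Fin d) × Ω => f p.2 p.1) (volume.prod μ) :=
      (hf.comp measurable_swap).aestronglyMeasurable
    refine h0.norm.mono' (h0.aestronglyMeasurable.mul hfm) ?_
    have : ∀ᵐ p ∂((volume : Measure (EuclideanSpace ℝ (Fin d))).prod μ), ∀ ξ, ‖f p.2 ξ‖ ≤ 1 :=
      Measure.quasiMeasurePreserving_snd.ae hf1
    filter_upwards [this] with p hp
    rw [norm_mul (G p.1 * m p.2)]
    exact mul_le_of_le_one_right (norm_nonneg _) (hp p.1)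
  have e : ∫ ξ, Complex.exp (Complex.I * ((inner ℝ x ξ : ℝ) : ℂ)) * ((∫ ω, m ω * f ω ξ ∂μ) * H ξ) =
      ∫ ω, m ω * (∫ ξ, Complex.exp (Complex.I * ((inner ℝ x ξ : ℝ) : ℂ)) * (f ω ξ * H ξ)) ∂μ := by
    have e1 : ∀ ξ, Complex.exp (Complex.I * ((inner ℝ x ξ : ℝ) : ℂ)) * ((∫ ω, m ω * f ω ξ ∂μ) * H ξ) =
        ∫ ω, G ξ * m ω * f ω ξ ∂μ := fun ξ => by
      have e2 : ∫ ω, G ξ * m ω * f ω ξ ∂μ = G ξ * ∫ ω, m ω * f ω ξ ∂μ := by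
        simp only [mul_assoc (G ξ), integral_const_mul]
      rw [e2]
      simp only [hG]
      ring
    simp only [e1]
    rw [integral_integral_swap hint]
    refine integral_congr_ae (Filter.Eventually.of_forall fun ω => ?_)
    beta_reduce
    rw [← integral_const_mul]
    refine integral_congr_ae (Filter.Eventually.of_forall fun ξ => ?_)
    simp only [hG]; ring
  rw [e, ← integral_mul_const]
  refine norm_integral_le_of_norm_le (hmc.mul_const B) ?_
  filter_upwards [h] with ω hω
  rw [norm_mul, mul_assoc]
  exact mul_le_mul_of_nonneg_left (hω H B hH hB x) (norm_nonneg _)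

/-- A Gaussian of complex width `w` is the Fourier transform of a Gaussian whose `L¹` norm is
`(|w| / Re w)^{d/2}`, independently of the scale of `w`. -/
theorem fourierMultBound_gaussian {w : ℂ} (hw : 0 < w.re) :
    FourierMultBound (fun ξ : EuclideanSpace ℝ (Fin d) => Complex.exp (-w * ((‖ξ‖ ^ 2 : ℝ) : ℂ)))
      ((‖w‖ / w.re) ^ ((d : ℝ) / 2)) := by
  have hw0 : w ≠ 0 := by rintro rfl; simp at hw
  have hwn := norm_pos_of_re_pos hw
  set b : ℂ := (4 * w)⁻¹ with hb
  have hbre : b.re = w.re / (4 * ‖w‖ ^ 2) := by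
    have h4 : ((4 : ℂ) * w).re = 4 * w.re := by simp
    rw [hb, Complex.inv_re, h4, Complex.normSq_eq_norm_sq, norm_mul, Complex.norm_ofNat]
    field_simp
  have hb0 : 0 < b.re := by rw [hbre]; positivity
  set c0 : ℂ := (Real.pi / b) ^ ((d : ℂ) / 2) with hc0
  have hpb : (Real.pi : ℂ) / b = 4 * Real.pi * w := by rw [hb]; field_simp
  have hpb0 : (Real.pi : ℂ) / b ≠ 0 := by
    rw [hpb]; exact mul_ne_zero (mul_ne_zero (by norm_num) (Complex.ofReal_ne_zero.2 Real.pi_ne_zero)) hw0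
  have hc0n : ‖c0‖ = (4 * Real.pi * ‖w‖) ^ ((d : ℝ) / 2) := by
    rw [hc0, show ((d : ℂ) / 2) = (((d : ℝ) / 2 : ℝ) : ℂ) by push_cast; rfl, Complex.norm_cpow_real, hpb,
      norm_mul, norm_mul, Complex.norm_ofNat, Complex.norm_real, Real.norm_of_nonneg Real.pi_pos.le]
  have hc00 : c0 ≠ 0 := by
    rw [← norm_ne_zero_iff, hc0n]; positivity
  have hgi : Integrable (fun y : EuclideanSpace ℝ (Fin d) => Complex.exp (-b * ‖y‖ ^ 2)) := by
    simpa using GaussianFourier.integrable_cexp_neg_mul_sq_norm_add hb0 0 (0 : EuclideanSpace ℝ (Fin d))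
  have hgn : ∀ y : EuclideanSpace ℝ (Fin d), ‖Complex.exp (-b * ‖y‖ ^ 2)‖ = Real.exp (-b.re * ‖y‖ ^ 2) := fun y => by
    rw [← Complex.ofReal_pow, norm_exp_neg_mul_ofReal]
  have hmi : Integrable (fun y : EuclideanSpace ℝ (Fin d) => c0⁻¹ * Complex.exp (-b * ‖y‖ ^ 2)) := hgi.const_mul _
  have key := FourierMultBound.integral (d := d) (μ := volume)
    (m := fun y : EuclideanSpace ℝ (Fin d) => c0⁻¹ * Complex.exp (-b * ‖y‖ ^ 2)) (c := fun _ => 1)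
    (f := fun y ξ => Complex.exp (Complex.I * ((inner ℝ y ξ : ℝ) : ℂ))) hmi (by simpa using hmi.norm)
    (Continuous.measurable (by unfold Function.uncurry; fun_prop))
    (Filter.Eventually.of_forall fun y ξ => (norm_exp_I_mul_ofReal _).le)
    (Filter.Eventually.of_forall fun y => fourierMultBound_character y)
  have e1 : (fun ξ : EuclideanSpace ℝ (Fin d) => ∫ y : EuclideanSpace ℝ (Fin d),
      c0⁻¹ * Complex.exp (-b * ‖y‖ ^ 2) * Complex.exp (Complex.I * ((inner ℝ y ξ : ℝ) : ℂ))) =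
      fun ξ => Complex.exp (-w * ((‖ξ‖ ^ 2 : ℝ) : ℂ)) := by
    ext ξ
    have h := GaussianFourier.integral_cexp_neg_mul_sq_norm_add hb0 Complex.I ξ
    rw [finrank_euclideanSpace_fin, ← hc0] at h
    simp only [mul_assoc, ← Complex.exp_add, integral_const_mul]
    simp only [real_inner_comm _ ξ] at h ⊢
    rw [h, ← mul_assoc, inv_mul_cancel₀ hc00, one_mul]
    congr 1
    rw [hb, Complex.I_sq]
    push_cast
    field_simp
  have e2 : ∫ y : EuclideanSpace ℝ (Fin d), ‖c0⁻¹ * Complex.exp (-b * ‖y‖ ^ 2)‖ * 1 =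
      (‖w‖ / w.re) ^ ((d : ℝ) / 2) := by
    simp only [norm_mul, mul_one, hgn, integral_const_mul]
    rw [GaussianFourier.integral_rexp_neg_mul_sq_norm hb0, finrank_euclideanSpace_fin, norm_inv, hc0n,
      ← Real.inv_rpow (by positivity), ← Real.mul_rpow (by positivity) (by positivity)]
    congr 1
    rw [hbre]
    field_simp
  rw [e1, e2] at key
  exact key

/-- The Cauchy–Schlömilch substitution `u = σ - c/σ`. -/
theorem integral_comp_sub_div_Ioi {F : ℝ → ℂ} (hF : Integrable F) (hFc : Continuous F) (heven : ∀ u, F (-u) = F u)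
    {c : ℝ} (hc : 0 < c) : 2 * ∫ σ in Set.Ioi (0 : ℝ), F (σ - c / σ) = ∫ u, F u := by
  have hd : ∀ σ ∈ Set.Ioi (0 : ℝ), HasDerivWithinAt (fun σ : ℝ => σ - c / σ) (1 + c / σ ^ 2) (Set.Ioi 0) σ :=
    fun σ hσ => by
    have hσ0 : (0 : ℝ) < σ := hσ
    refine ((hasDerivAt_id σ).sub ((hasDerivAt_const σ c).div (hasDerivAt_id σ) hσ0.ne')).hasDerivWithinAt.congr_deriv ?_
    simp only [id]; field_simp; ring
  have hinj : Set.InjOn (fun σ : ℝ => σ - c / σ) (Set.Ioi 0) := by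
    intro a ha b hb hab
    have ha0 : (0 : ℝ) < a := ha
    have hb0 : (0 : ℝ) < b := hb
    beta_reduce at hab
    field_simp at hab
    have : (a - b) * (a * b + c) = 0 := by linarith
    rcases mul_eq_zero.1 this with h | h
    · linarith
    · have := mul_pos ha0 hb0; linarith
  have himg : (fun σ : ℝ => σ - c / σ) '' Set.Ioi 0 = Set.univ := by
    refine Set.eq_univ_of_forall fun u => ?_
    have hs := Real.sq_sqrt (by positivity : 0 ≤ u ^ 2 + 4 * c)
    have hpos : 0 < u + √(u ^ 2 + 4 * c) := by
      have : |u| < √(u ^ 2 + 4 * c) := Real.lt_sqrt_of_sq_lt (by rw [sq_abs]; linarith)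
      linarith [neg_abs_le u]
    refine ⟨(u + √(u ^ 2 + 4 * c)) / 2, by simp only [Set.mem_Ioi]; positivity, ?_⟩
    beta_reduce
    field_simp
    nlinarith
  have k1 := integral_image_eq_integral_abs_deriv_smul measurableSet_Ioi hd hinj F
  have i1 := (integrableOn_image_iff_integrableOn_abs_deriv_smul measurableSet_Ioi hd hinj F).1
    (by rw [himg]; exact hF.integrableOn)
  rw [himg, setIntegral_univ] at k1
  have habs : ∀ σ : ℝ, |1 + c / σ ^ 2| = 1 + c / σ ^ 2 := fun σ => abs_of_pos (by positivity)
  simp only [habs] at k1 i1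
  have hcont : ContinuousOn (fun σ : ℝ => F (σ - c / σ)) (Set.Ioi 0) :=
    hFc.comp_continuousOn (continuousOn_id.sub (continuousOn_const.div continuousOn_id fun σ hσ => ne_of_gt hσ))
  have i2 : IntegrableOn (fun σ : ℝ => F (σ - c / σ)) (Set.Ioi 0) := by
    refine i1.norm.mono' (hcont.aestronglyMeasurable measurableSet_Ioi) (Filter.Eventually.of_forall fun σ => ?_)
    rw [norm_smul, Real.norm_of_nonneg (by positivity)]
    have : 0 ≤ c / σ ^ 2 := by positivity
    exact le_mul_of_one_le_left (norm_nonneg _) (by linarith)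
  -- the inversion `σ ↦ c/σ` exchanges the two halves of `du`
  have hd2 : ∀ σ ∈ Set.Ioi (0 : ℝ), HasDerivWithinAt (fun σ : ℝ => c / σ) (-(c / σ ^ 2)) (Set.Ioi 0) σ :=
    fun σ hσ => by
    have hσ0 : (0 : ℝ) < σ := hσ
    refine ((hasDerivAt_const σ c).div (hasDerivAt_id σ) hσ0.ne').hasDerivWithinAt.congr_deriv ?_
    simp only [id]; field_simp; ring
  have hinj2 : Set.InjOn (fun σ : ℝ => c / σ) (Set.Ioi 0) := by
    intro a ha b hb hab
    have ha0 : (0 : ℝ) < a := ha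
    have hb0 : (0 : ℝ) < b := hb
    beta_reduce at hab
    field_simp at hab
    linarith
  have himg2 : (fun σ : ℝ => c / σ) '' Set.Ioi 0 = Set.Ioi 0 := by
    ext u
    constructor
    · rintro ⟨σ, hσ, rfl⟩
      exact div_pos hc hσ
    · intro hu
      have hu0 : (0 : ℝ) < u := hu
      exact ⟨c / u, div_pos hc hu0, by beta_reduce; field_simp⟩
  have k2 := integral_image_eq_integral_abs_deriv_smul measurableSet_Ioi hd2 hinj2 (fun σ => F (σ - c / σ))
  rw [himg2] at k2
  have k3 : ∫ σ in Set.Ioi (0 : ℝ), |-(c / σ ^ 2)| • F (c / σ - c / (c / σ)) =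
      ∫ σ in Set.Ioi (0 : ℝ), (c / σ ^ 2) • F (σ - c / σ) := by
    refine setIntegral_congr_fun measurableSet_Ioi fun σ hσ => ?_
    have hσ0 : (0 : ℝ) < σ := hσ
    rw [abs_neg, abs_of_pos (by positivity), ← heven (σ - c / σ)]
    congr 2
    field_simp
    ring
  rw [k3] at k2
  have i3 : IntegrableOn (fun σ : ℝ => (c / σ ^ 2) • F (σ - c / σ)) (Set.Ioi 0) := by
    refine (i1.sub i2).congr (Filter.Eventually.of_forall fun σ => ?_)
    simp only [Pi.sub_apply, add_smul, one_smul, add_sub_cancel_left]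
  simp only [add_smul, one_smul] at k1
  rw [k1, integral_add i2 i3, ← k2]
  ring

/-- Subordination of `e^{-zr}` to Gaussians in `r`. -/
theorem integral_exp_subordination {z : ℂ} (hz : 0 < z.re) {r : ℝ} (hr : 0 ≤ r) :
    ∫ σ in Set.Ioi (0 : ℝ), 2 * (z / Real.pi) ^ (1 / 2 : ℂ) * Complex.exp (-z * ((σ ^ 2 : ℝ) : ℂ)) *
      Complex.exp (-(z / ((4 * σ ^ 2 : ℝ) : ℂ)) * ((r ^ 2 : ℝ) : ℂ)) = Complex.exp (-z * r) := by
  have hz0 : z ≠ 0 := by rintro rfl; simp at hz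
  have hp0 : (Real.pi : ℂ) ≠ 0 := Complex.ofReal_ne_zero.2 Real.pi_ne_zero
  have hcst : (z / Real.pi) ^ (1 / 2 : ℂ) * (Real.pi / z) ^ (1 / 2 : ℂ) = 1 := by
    have harg : (z / Real.pi : ℂ).arg ≠ Real.pi := by
      intro h
      rw [Complex.arg_eq_pi_iff] at h
      have : (z / Real.pi : ℂ).re = z.re / Real.pi := Complex.div_ofReal_re z _
      have := div_pos hz Real.pi_pos
      linarith
    rw [← inv_div z, Complex.inv_cpow _ _ harg, mul_inv_cancel₀]
    rw [Complex.cpow_def_of_ne_zero (div_ne_zero hz0 hp0)]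
    exact Complex.exp_ne_zero _
  simp only [mul_assoc, integral_const_mul]
  rcases hr.eq_or_lt with rfl | hr0
  · have h := integral_gaussian_complex_Ioi hz
    simp only [Complex.ofReal_pow]
    simp only [Complex.ofReal_zero, ne_eq, OfNat.ofNat_ne_zero, not_false_eq_true, zero_pow, mul_zero,
      Complex.exp_zero, mul_one]
    rw [h]
    linear_combination hcst
  · have hF : Integrable fun u : ℝ => Complex.exp (-z * (u : ℂ) ^ 2) := integrable_cexp_neg_mul_sq hz
    have h := integral_comp_sub_div_Ioi hF (by fun_prop) (fun u => by simp) (half_pos hr0)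
    rw [integral_gaussian_complex hz] at h
    have e : ∫ σ in Set.Ioi (0 : ℝ), Complex.exp (-z * ((σ ^ 2 : ℝ) : ℂ)) *
        Complex.exp (-(z / ((4 * σ ^ 2 : ℝ) : ℂ)) * ((r ^ 2 : ℝ) : ℂ)) =
        Complex.exp (-z * r) * ∫ σ in Set.Ioi (0 : ℝ), Complex.exp (-z * ((σ - r / 2 / σ : ℝ) : ℂ) ^ 2) := by
      rw [← integral_const_mul]
      refine setIntegral_congr_fun measurableSet_Ioi fun σ hσ => ?_
      have hσ0 : (σ : ℂ) ≠ 0 := Complex.ofReal_ne_zero.2 (ne_of_gt hσ)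
      simp only [← Complex.exp_add]
      congr 1
      push_cast
      field_simp
      ring
    rw [e]
    linear_combination (z / Real.pi) ^ (1 / 2 : ℂ) * Complex.exp (-z * r) * h + Complex.exp (-z * r) * hcst

/-- The constant depends only on `|z| / Re z`: in the subordination formula all the Gaussian widths
`z / (4σ²)` have the argument of `z`. -/
theorem fourierMultBound_exp_neg_mul_norm {z : ℂ} (hz : 0 < z.re) :
    FourierMultBound (fun ξ : EuclideanSpace ℝ (Fin d) => Complex.exp (-z * ‖ξ‖))
      ((‖z‖ / z.re) ^ (((d : ℝ) + 1) / 2)) := by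
  have hzn := norm_pos_of_re_pos hz
  have hratio : 0 < ‖z‖ / z.re := by positivity
  set k : ℂ := 2 * (z / Real.pi) ^ (1 / 2 : ℂ) with hk
  have hkn : ‖k‖ = 2 * (‖z‖ / Real.pi) ^ (1 / 2 : ℝ) := by
    rw [hk, norm_mul, Complex.norm_ofNat, show (1 / 2 : ℂ) = ((1 / 2 : ℝ) : ℂ) by push_cast; rfl,
      Complex.norm_cpow_real, norm_div, Complex.norm_real, Real.norm_of_nonneg Real.pi_pos.le]
  have hmi : IntegrableOn (fun σ : ℝ => k * Complex.exp (-z * ((σ ^ 2 : ℝ) : ℂ))) (Set.Ioi 0) := by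
    have := (integrable_cexp_neg_mul_sq hz).const_mul k
    simp only [← Complex.ofReal_pow] at this
    exact this.integrableOn
  have hmeas : Measurable (Function.uncurry fun (σ : ℝ) (ξ : EuclideanSpace ℝ (Fin d)) =>
      Complex.exp (-(z / ((4 * σ ^ 2 : ℝ) : ℂ)) * ((‖ξ‖ ^ 2 : ℝ) : ℂ))) := by
    unfold Function.uncurry; fun_prop
  have hre : ∀ σ ∈ Set.Ioi (0 : ℝ), 0 < (z / ((4 * σ ^ 2 : ℝ) : ℂ)).re := fun σ hσ => by
    have hσ0 : (0 : ℝ) < σ := hσ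
    rw [Complex.div_ofReal_re]; positivity
  have key := FourierMultBound.integral (d := d) (c := fun _ => (‖z‖ / z.re) ^ ((d : ℝ) / 2)) hmi
    (hmi.norm.mul_const _) hmeas
    ((ae_restrict_iff' measurableSet_Ioi).2 (Filter.Eventually.of_forall fun σ hσ ξ =>
      norm_exp_neg_mul_ofReal_le_one (hre σ hσ) (by positivity)))
    ((ae_restrict_iff' measurableSet_Ioi).2 (Filter.Eventually.of_forall fun σ hσ => by
      have hσ0 : (0 : ℝ) < σ := hσ
      have := fourierMultBound_gaussian (d := d) (hre σ hσ)
      have e : ‖z / ((4 * σ ^ 2 : ℝ) : ℂ)‖ / (z / ((4 * σ ^ 2 : ℝ) : ℂ)).re = ‖z‖ / z.re := by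
        rw [Complex.div_ofReal_re, norm_div, Complex.norm_real, Real.norm_of_nonneg (by positivity)]
        field_simp
      rwa [e] at this))
  have e1 : ∫ σ in Set.Ioi (0 : ℝ), ‖k * Complex.exp (-z * ((σ ^ 2 : ℝ) : ℂ))‖ * (‖z‖ / z.re) ^ ((d : ℝ) / 2) =
      (‖z‖ / z.re) ^ (((d : ℝ) + 1) / 2) := by
    simp only [norm_mul, norm_exp_neg_mul_ofReal, integral_mul_const, integral_const_mul]
    rw [integral_gaussian_Ioi, hkn, Real.sqrt_eq_rpow]
    have : 2 * (‖z‖ / Real.pi) ^ (1 / 2 : ℝ) * ((Real.pi / z.re) ^ (1 / 2 : ℝ) / 2) = (‖z‖ / z.re) ^ (1 / 2 : ℝ) := by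
      have : (‖z‖ / Real.pi) ^ (1 / 2 : ℝ) * (Real.pi / z.re) ^ (1 / 2 : ℝ) = (‖z‖ / z.re) ^ (1 / 2 : ℝ) := by
        rw [← Real.mul_rpow (by positivity) (by positivity)]
        congr 1
        have := Real.pi_pos
        field_simp
      linarith
    rw [this, ← Real.rpow_add hratio]
    congr 1; ring
  rw [e1] at key
  convert key using 2 with ξ
  rw [← integral_exp_subordination hz (norm_nonneg ξ)]

/-- The cutoff `ψ(ε|ξ|)` is a multiplier with a constant that does not depend on `ε`. It need not be
smooth at `ξ = 0`, which is why it is written as a superposition of the functions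
`e^{-ε(1 - 2πib)|ξ|}` with rapidly decreasing weight in `b`. -/
theorem exists_fourierMultBound_cutoff (d : ℕ) {ψ : ℝ → ℂ} (hψ : ContDiff ℝ (⊤ : ℕ∞) ψ)
    (hψc : HasCompactSupport ψ) :
    ∃ C : ℝ, 0 ≤ C ∧ ∀ ε : ℝ, 0 < ε →
      FourierMultBound (fun ξ : EuclideanSpace ℝ (Fin d) => ψ (ε * ‖ξ‖)) C := by
  -- `e^r ψ(r)` is a superposition of the characters `e^{2πibr}`
  set φ : ℝ → ℂ := fun r => Complex.exp r * ψ r with hφ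
  have hφs : ContDiff ℝ (⊤ : ℕ∞) φ := (Complex.ofRealCLM.contDiff.cexp).mul hψ
  have hφc : HasCompactSupport φ := hψc.mul_left
  set g : SchwartzMap ℝ ℂ := hφc.toSchwartzMap hφs with hg
  have hgφ : (g : ℝ → ℂ) = φ := rfl
  set m : SchwartzMap ℝ ℂ := FourierTransform.fourier g with hm
  have hinv : ∀ r : ℝ, φ r = ∫ b : ℝ, m b * Complex.exp (2 * Real.pi * Complex.I * b * r) := fun r => by
    have h1 : (FourierTransform.fourierInv m : SchwartzMap ℝ ℂ) = g := FourierTransform.fourierInv_fourier_eq g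
    rw [← hgφ, ← h1, SchwartzMap.fourierInv_coe, Real.fourierInv_eq']
    refine integral_congr_ae (Filter.Eventually.of_forall fun b => ?_)
    simp only [smul_eq_mul]
    rw [mul_comm]
    congr 2
    simp
    ring
  have hmi : Integrable (m : ℝ → ℂ) := m.integrable
  have hmc : Integrable fun b : ℝ => ‖m b‖ * (1 + 2 * Real.pi * |b|) ^ (d + 1) := by
    have h1 := ((m.integrable_pow_mul volume (d + 1)).const_mul ((2 * Real.pi) ^ (d + 1))).add hmi.norm
    refine (h1.const_mul (2 ^ d)).mono' ?_ (Filter.Eventually.of_forall fun b => ?_)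
    · exact Continuous.aestronglyMeasurable (m.continuous.norm.mul (by fun_prop))
    · rw [Real.norm_of_nonneg (by positivity)]
      have := add_pow_le zero_le_one (by positivity : 0 ≤ 2 * Real.pi * |b|) (d + 1)
      simp only [Pi.add_apply, Real.norm_eq_abs]
      calc _ ≤ ‖m b‖ * (2 ^ (d + 1 - 1) * (1 ^ (d + 1) + (2 * Real.pi * |b|) ^ (d + 1))) := by gcongr
        _ = _ := by rw [add_tsub_cancel_right, one_pow, mul_pow]; ring
  refine ⟨∫ b : ℝ, ‖m b‖ * (1 + 2 * Real.pi * |b|) ^ (d + 1), integral_nonneg fun b => by positivity,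
    fun ε hε => ?_⟩
  set z : ℝ → ℂ := fun b => ε * (1 - 2 * Real.pi * Complex.I * b) with hz
  have hzre : ∀ b, (z b).re = ε := fun b => by simp [hz]
  have hzn : ∀ b, ‖z b‖ / (z b).re ≤ 1 + 2 * Real.pi * |b| := fun b => by
    rw [hzre, div_le_iff₀ hε]
    simp only [hz]
    rw [norm_mul, Complex.norm_real, Real.norm_of_nonneg hε.le, mul_comm]
    gcongr
    refine (norm_sub_le _ _).trans (le_of_eq ?_)
    simp [abs_of_pos Real.pi_pos]
  have key := FourierMultBound.integral (d := d) (μ := volume)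
    (f := fun (b : ℝ) (ξ : EuclideanSpace ℝ (Fin d)) => Complex.exp (-z b * ‖ξ‖)) hmi hmc
    (Continuous.measurable (by unfold Function.uncurry; fun_prop))
    (Filter.Eventually.of_forall fun b ξ =>
      norm_exp_neg_mul_ofReal_le_one ((hzre b).symm ▸ hε) (norm_nonneg ξ))
    (Filter.Eventually.of_forall fun b => by
      refine (fourierMultBound_exp_neg_mul_norm (d := d) (z := z b) ((hzre b).symm ▸ hε)).mono ?_
      have h0 : 0 ≤ ‖z b‖ / (z b).re := div_nonneg (norm_nonneg _) ((hzre b).symm ▸ hε.le)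
      have h1 : 1 ≤ 1 + 2 * Real.pi * |b| := by
        have : 0 ≤ 2 * Real.pi * |b| := by positivity
        linarith
      calc _ ≤ (1 + 2 * Real.pi * |b|) ^ (((d : ℝ) + 1) / 2) :=
            Real.rpow_le_rpow h0 (hzn b) (by positivity)
        _ ≤ (1 + 2 * Real.pi * |b|) ^ ((d + 1 : ℕ) : ℝ) :=
            Real.rpow_le_rpow_of_exponent_le h1 (by
              push_cast
              have : (0 : ℝ) ≤ d := by positivity
              linarith)
        _ = _ := Real.rpow_natCast _ _)
  convert key using 2 with ξ
  have h1 : ψ (ε * ‖ξ‖) = Complex.exp (-((ε * ‖ξ‖ : ℝ) : ℂ)) * φ (ε * ‖ξ‖) := by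
    simp only [hφ]
    rw [← mul_assoc, ← Complex.exp_add, neg_add_cancel, Complex.exp_zero, one_mul]
  rw [h1, hinv, ← integral_const_mul]
  refine integral_congr_ae (Filter.Eventually.of_forall fun b => ?_)
  simp only [hz]
  rw [mul_left_comm, ← Complex.exp_add]
  congr 2
  push_cast
  ring

end mult

/-! ### Removal of the damping -/

theorem proposition3p4 (d : ℕ) (hd : 1 ≤ d) (ψ : ℝ → ℂ)
    (hψ : ContDiff ℝ (⊤ : ℕ∞) ψ) (hψ_supp : tsupport ψ ⊆ Set.Ioo (-1) 1) :
    ∃ C N : ℝ, 0 < N ∧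
      ∀ (κ ε : ℝ), 0 < ε → ∀ (x : EuclideanSpace ℝ (Fin d)) (t : ℝ), t ≠ 0 →
        ‖kleinGordonIntegral ψ κ ε x t‖ ≤
          C * (1 + |κ|) ^ N * |t| ^ (-(d : ℝ) / 2) := by
  obtain ⟨n, rfl⟩ : ∃ n, d = n + 1 := ⟨d - 1, by omega⟩
  have hψc : HasCompactSupport ψ :=
    isCompact_Icc.of_isClosed_subset (isClosed_tsupport ψ) (hψ_supp.trans Set.Ioo_subset_Icc_self)
  obtain ⟨C1, hC1, h1⟩ := exists_fourierMultBound_cutoff (n + 1) hψ hψc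
  obtain ⟨C2, hC2, N, h2⟩ := exists_norm_integral_exp_mul_kgSymbol_le n
  refine ⟨C1 * C2, N + 1, by positivity, fun κ ε hε x t ht => ?_⟩
  have hκ : 1 ≤ 1 + |κ| := by have := abs_nonneg κ; linarith
  set f : EuclideanSpace ℝ (Fin (n + 1)) → ℂ := fun ξ => ψ (ε * ‖ξ‖) with hf
  have hfc : Continuous f := hψ.continuous.comp (by fun_prop)
  have hfi : Integrable f := by
    refine hfc.integrable_of_hasCompactSupport ?_
    refine HasCompactSupport.intro (isCompact_closedBall (0 : EuclideanSpace ℝ (Fin (n + 1))) ε⁻¹) fun ξ hξ => ?_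
    rw [mem_closedBall_zero_iff, not_le, inv_lt_iff_one_lt_mul₀ hε] at hξ
    refine image_eq_zero_of_notMem_tsupport (f := ψ) fun h => ?_
    have := (hψ_supp h).2
    rw [mul_comm] at hξ
    linarith
  have hbound : ∀ δ : ℝ, 0 < δ →
      ‖∫ ξ, Complex.exp (Complex.I * ((inner ℝ x ξ : ℝ) : ℂ)) * (f ξ * kgSymbol κ δ t ξ)‖ ≤
        C1 * (C2 * (1 + |κ|) ^ N * |t| ^ (-((n + 1 : ℕ) : ℝ) / 2)) := fun δ hδ =>
    h1 ε hε (kgSymbol κ δ t) _ (integrable_kgSymbol hδ κ t) (fun y => h2 κ δ t y hδ ht) x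
  -- remove the damping
  have hlim : Filter.Tendsto (fun δ : ℝ => ∫ ξ, Complex.exp (Complex.I * ((inner ℝ x ξ : ℝ) : ℂ)) *
      (f ξ * kgSymbol κ δ t ξ)) (nhdsWithin 0 (Set.Ioi 0)) (nhds (kleinGordonIntegral ψ κ ε x t)) := by
    have e : kleinGordonIntegral ψ κ ε x t = ∫ ξ, Complex.exp (Complex.I * ((inner ℝ x ξ : ℝ) : ℂ)) *
        (f ξ * kgSymbol κ 0 t ξ) := by
      rw [kleinGordonIntegral]
      refine integral_congr_ae (Filter.Eventually.of_forall fun ξ => ?_)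
      have : Complex.exp (Complex.I * ((inner ℝ x ξ + t * japaneseBracket ξ : ℝ) : ℂ)) =
          Complex.exp (Complex.I * ((inner ℝ x ξ : ℝ) : ℂ)) * Complex.exp (-dampedTime 0 t * japaneseBracket ξ) := by
        rw [← Complex.exp_add]; congr 1; simp only [dampedTime]; push_cast; ring
      simp only [kgSymbol, hf, this]
      ring
    rw [e]
    refine tendsto_integral_filter_of_dominated_convergence (fun ξ => ‖f ξ‖) ?_ ?_ hfi.norm ?_
    · refine Filter.Eventually.of_forall fun δ => Continuous.aestronglyMeasurable ?_
      have := continuous_kgSymbol (d := n + 1) κ δ t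
      fun_prop
    · filter_upwards [self_mem_nhdsWithin] with δ hδ
      refine Filter.Eventually.of_forall fun ξ => ?_
      rw [norm_mul, norm_mul, norm_exp_I_mul_ofReal, one_mul]
      refine mul_le_of_le_one_right (norm_nonneg _) ((norm_kgSymbol_le κ δ t ξ).trans (Real.exp_le_one_iff.2 ?_))
      have hδ0 : (0 : ℝ) < δ := hδ
      have := one_le_japaneseBracket ξ
      nlinarith
    · refine Filter.Eventually.of_forall fun ξ => ?_
      refine tendsto_const_nhds.mul (tendsto_const_nhds.mul ?_)
      have : Continuous fun δ : ℝ => kgSymbol κ δ t ξ := by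
        unfold kgSymbol dampedTime; fun_prop
      exact (this.tendsto 0).mono_left nhdsWithin_le_nhds
  refine (le_of_tendsto hlim.norm (by
    filter_upwards [self_mem_nhdsWithin] with δ hδ using hbound δ hδ)).trans ?_
  rw [← mul_assoc, ← mul_assoc]
  refine mul_le_mul_of_nonneg_right (mul_le_mul_of_nonneg_left ?_ (by positivity)) (by positivity)
  rw [← Real.rpow_natCast]
  exact Real.rpow_le_rpow_of_exponent_le hκ (by linarith)
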